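/- Let $R\subset\mathbb R^N$ be a finite root system, i.e. a finite set of non-zero vectors with $R\cap\mathbb R\alpha=\{\pm\alpha\}$ and $\sigma_\alpha R=R$ for all $\alpha\in R$, where $\sigma_\alpha$ is the reflection in the hyperplane orthogonal to $\alpha$; assume $|\alpha|=\sqrt2$ for all $\alpha\in R$. Let $R_+=\{\alpha\in R:\langle\alpha,\beta\rangle>0\}$ for some $\beta$ orthogonal to no root, and let $k:R\to[0,\infty)$ be invariant under the group generated by the $\sigma_\alpha$. Let $$T_if(x)=\partial_if(x)+\sum_{\alpha\in R_+}k(\alpha)\,\alpha_i\,\frac{f(x)-f(\sigma_\alpha x)}{\langle\alpha,x\rangle}\quad(i=1,\dots,N),\qquad \Delta_k=\sum_{j=1}^NT_j^2,$$ (the quotient being read as its limit where $\langle\alpha,x\rangle=0$) be the Dunkl operators and the Dunkl Laplacian. On $\mathcal P=\mathbb C[\mathbb R^N]$, with $\mathcal P_n$ the homogeneous polynomials of degree $n$, there is a unique linear map $V$ with $V(\mathcal P_n)=\mathcal P_n$ for all $n$, $V|_{\mathcal P_0}=\mathrm{id}$ and $T_iV=V\partial_i$ for all $i$. Let $m_\nu=V(x^\nu)$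 be the moment functions and, for $x\in\mathbb R^N$ and $z\in\mathbb C^N$, let $K(x,z)=V(e^{\langle\cdot,z\rangle})(x)=\sum_{n\ge0}\frac1{n!}V(\langle\cdot,z\rangle^n)(x)$ be the Dunkl kernel, where $\langle x,z\rangle=\sum_ix_iz_i$. For a multi-index $\nu\in\mathbb Z_+^N$, define the Appell characters (for $t\in\mathbb R$) and the Appell cocharacters (for $t\in\mathbb R\setminus\{0\}$) by $$R_\nu(t,x)=i^{|\nu|}\,\partial_y^\nu\Bigl(K(x,-iy)\,e^{t|y|^2}\Bigr)\Big|_{y=0},\qquad S_\nu(t,y)=T_x^\nu\Bigl(e^{-|x|^2/4t}\,K(x,y/2t)\Bigr)\Big|_{x=0}\qquad(x,y\in\mathbb R^N),$$ where $T_x^\nu=T_1^{\nu_1}\cdots T_N^{\nu_N}$ acts in the variable $x$. Then $\Delta_k^np=0$ for every $p\in\mathcal P$ and every $n$ with $2n>\deg p$, so that $e^{-t\Delta_k}p=\sum_{n\ge0}\frac{(-t)^n}{n!}\Delta_k^np$ is a terminating series, and for all $x\in\mathbb R^N$ and $\nu\in\mathbb Z_+^N$ $$R_\nu(t,x)=e^{-t\Delta_k}m_\nu(x)\quad(t\in\mathbb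 R),\qquad S_\nu(t,x)=\Bigl(\frac1{2t}\Bigr)^{|\nu|}e^{-t\Delta_k}x^\nu\quad(t\in\mathbb R\setminus\{0\}).$$ -/

import Mathlib

namespace Dunkl

/-- The Euclidean space `ℝ^N`. -/
abbrev Space (N : ℕ) : Type := EuclideanSpace ℝ (Fin N)

/-- The algebra `ℂ[ℝ^N]` of polynomials in `N` variables with complex coefficients. -/
abbrev Poly (N : ℕ) : Type := MvPolynomial (Fin N) ℂ

/-- The function on `ℝ^N` defined by a polynomial. -/
noncomputable def polyFun {N : ℕ} (p : Poly N) : Space N → ℂ :=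
  fun x => MvPolynomial.eval (fun i => (x i : ℂ)) p

/-- The reflection `σ_α` in the hyperplane orthogonal to `α`. -/
noncomputable def rootRefl {N : ℕ} (α x : Space N) : Space N :=
  x - (2 * inner ℝ α x / ‖α‖ ^ 2) • α

/-- A (reduced, not necessarily crystallographic or spanning) root system in `ℝ^N`, all of whose
roots have length `√2`; in particular no root is zero. -/
structure IsNormalizedRootSystem {N : ℕ} (R : Finset (Space N)) : Prop where
  norm_eq : ∀ α ∈ R, ‖α‖ = Real.sqrt 2
  inter_line : ∀ α ∈ R, (R : Set (Space N)) ∩ {v | ∃ c : ℝ, v = c • α} = {α, -α}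
  refl_image : ∀ α ∈ R, rootRefl α '' (R : Set (Space N)) = (R : Set (Space N))

/-- A non-negative multiplicity function on `R`: it is invariant under the reflections `σ_β`,
`β ∈ R`, hence under the reflection group they generate. Only its values on `R` matter. -/
structure IsMultiplicity {N : ℕ} (R : Finset (Space N)) (k : Space N → ℝ) : Prop where
  invariant : ∀ α ∈ R, ∀ β ∈ R, k (rootRefl β α) = k α
  nonneg : ∀ α ∈ R, 0 ≤ k α

/-- The positive subsystem of `R` determined by a vector `β`. -/
noncomputable def posRoots {N : ℕ} (R : Finset (Space N)) (β : Space N) : Finset (Space N) :=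
  R.filter (fun α => 0 < inner ℝ α β)

/-- The partial derivative `∂_i f`. -/
noncomputable def partialD {N : ℕ} (i : Fin N) (f : Space N → ℂ) : Space N → ℂ :=
  fun x => fderiv ℝ f x (EuclideanSpace.single i 1)

/-- The difference quotient `(f(x) - f(σ_α x)) / ⟨α, x⟩`; on the hyperplane `⟨α, x⟩ = 0` it is
read as its limit, the derivative of `f` at `x` in the direction `(2 / |α|²) α`. -/
noncomputable def reflQuot {N : ℕ} (α : Space N) (f : Space N → ℂ) : Space N → ℂ :=
  open Classical in
  fun x =>
    if inner ℝ α x = 0 then fderiv ℝ f x ((2 / ‖α‖ ^ 2) • α)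
    else (f x - f (rootRefl α x)) / ((inner ℝ α x : ℝ) : ℂ)

/-- The Dunkl operator `T_i` for the positive roots `Rp` and the multiplicity function `k`. -/
noncomputable def dunklOp {N : ℕ} (Rp : Finset (Space N)) (k : Space N → ℝ) (i : Fin N)
    (f : Space N → ℂ) : Space N → ℂ :=
  fun x => partialD i f x + ∑ α ∈ Rp, (k α : ℂ) * (α i : ℂ) * reflQuot α f x

/-- `A^ν = A_1^{ν_1} ⋯ A_N^{ν_N}` for a family of operators `A_i` on functions. -/
def opPow {N : ℕ} (A : Fin N → (Space N → ℂ) → (Space N → ℂ)) (ν : Fin N →₀ ℕ)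
    (f : Space N → ℂ) : Space N → ℂ :=
  (List.finRange N).foldr (fun i g => (A i)^[ν i] g) f

/-- The Dunkl Laplacian `Δ_k = ∑_j T_j²`. -/
noncomputable def dunklLaplacian {N : ℕ} (Rp : Finset (Space N)) (k : Space N → ℝ)
    (f : Space N → ℂ) : Space N → ℂ :=
  fun x => ∑ j, dunklOp Rp k j (dunklOp Rp k j f) x

/-- The operator series `e^{c Δ_k} f = ∑_n c^n / n! Δ_k^n f`, evaluated pointwise. -/
noncomputable def expLaplacian {N : ℕ} (Rp : Finset (Space N)) (k : Space N → ℝ) (c : ℝ)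
    (f : Space N → ℂ) : Space N → ℂ :=
  fun x => ∑' n : ℕ, ((c ^ n / (n.factorial : ℝ) : ℝ) : ℂ) * (dunklLaplacian Rp k)^[n] f x

/-- The properties characterizing the intertwining operator `V`: it maps the space of homogeneous
polynomials of each degree onto itself, is the identity on constants, and `T_i V = V ∂_i`. -/
structure IsIntertwining {N : ℕ} (Rp : Finset (Space N)) (k : Space N → ℝ)
    (V : Poly N →ₗ[ℂ] Poly N) : Prop where
  map_homogeneous : ∀ n : ℕ, (MvPolynomial.homogeneousSubmodule (Fin N) ℂ n).map V =
    MvPolynomial.homogeneousSubmodule (Fin N) ℂ n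
  map_const : ∀ c : ℂ, V (MvPolynomial.C c) = MvPolynomial.C c
  intertwines : ∀ (i : Fin N) (p : Poly N),
    dunklOp Rp k i (polyFun (V p)) = polyFun (V (MvPolynomial.pderiv i p))

/-- The intertwining operator `V`, the linear map with the characterizing properties above. -/
noncomputable def intertwiner {N : ℕ} (Rp : Finset (Space N)) (k : Space N → ℝ) :
    Poly N →ₗ[ℂ] Poly N :=
  Classical.epsilon (IsIntertwining Rp k)

/-- The monomial `x^ν`. -/
noncomputable def xPow {N : ℕ} (ν : Fin N →₀ ℕ) : Poly N := MvPolynomial.monomial ν 1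

/-- The moment function `m_ν = V(x^ν)`. -/
noncomputable def moment {N : ℕ} (Rp : Finset (Space N)) (k : Space N → ℝ)
    (ν : Fin N →₀ ℕ) : Poly N :=
  intertwiner Rp k (xPow ν)

/-- The Dunkl kernel `K(x, z) = V(e^{⟨·, z⟩})(x)` for `x ∈ ℝ^N`, `z ∈ ℂ^N`. Here `V` is extended
from polynomials to series of homogeneous polynomials term by term, `V(∑ f_n) = ∑ V f_n`, and
`f_n = ⟨·, z⟩^n / n!` with the bilinear form `⟨w, z⟩ = ∑ w_i z_i`. -/
noncomputable def kernel {N : ℕ} (Rp : Finset (Space N)) (k : Space N → ℝ)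
    (x : Space N) (z : Fin N → ℂ) : ℂ :=
  ∑' n : ℕ, polyFun (intertwiner Rp k
    (((n.factorial : ℂ)⁻¹) • (∑ i, MvPolynomial.C (z i) * MvPolynomial.X i) ^ n)) x

/-- The Appell characters: `R_ν(t, x)` is the coefficient of `(-iy)^ν / ν!` in the power series
of `y ↦ K(x, -iy) e^{t |y|²}`, that is, `i^{|ν|}` times its `ν`-th partial derivative at `0`. -/
noncomputable def appellR {N : ℕ} (Rp : Finset (Space N)) (k : Space N → ℝ)
    (ν : Fin N →₀ ℕ) (t : ℝ) (x : Space N) : ℂ :=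
  Complex.I ^ ν.degree * opPow partialD ν
    (fun y : Space N => kernel Rp k x (fun i => -Complex.I * (y i : ℂ)) *
      ((Real.exp (t * ‖y‖ ^ 2) : ℝ) : ℂ)) 0

/-- The Appell cocharacters: `S_ν(t, y) = T_x^ν (e^{-|x|²/4t} K(x, y/2t))` at `x = 0`, for
`t ≠ 0`. -/
noncomputable def appellS {N : ℕ} (Rp : Finset (Space N)) (k : Space N → ℝ)
    (ν : Fin N →₀ ℕ) (t : ℝ) (y : Space N) : ℂ :=
  opPow (dunklOp Rp k) ν
    (fun x : Space N => ((Real.exp (-‖x‖ ^ 2 / (4 * t)) : ℝ) : ℂ) *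
      kernel Rp k x (fun i => ((y i / (2 * t) : ℝ) : ℂ))) 0

end Dunkl

namespace Dunkl

/-! Both formulas come from the pairing [p, q] = (p(T)q)(0) on polynomials. Multiplication by x_i is
adjoint to T_i in either argument (`dunklPair_X_mul`, `dunklPair_X_mul_right`), so multiplication by
|x|² is adjoint to Δ_k. The kernel reproduces values: [p, K(·,z)] = p(z), degree by degree
(`PolyIntertwining.dunklPair_kernelPoly`). Hence T^ν(e^{c|x|²} K(x,z)) at x = 0 equals (e^{cΔ_k}
x^ν)(z); with c = -1/4t, z = y/2t and homogeneity this is the formula for S_ν. For R_ν the same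
computation runs in the variable y with the empty root system, where T_i = ∂_i. It gives V(e^{-tΔ}
x^ν)(x), and VΔ = Δ_k V finishes.

Existence of V rests on a maximum principle. In degree n the operator ∑ x_i T_i is n + ∑ k(α)(1 -
σ_α). Since k ≥ 0 and the reflections preserve balls, looking at a point where |p| is maximal shows
that this operator is bounded below by n in the sup norm on balls (`mul_norm_cEval_le`); so it is
invertible in positive degree. V is then built by degree, Vp being the solution of (n + ∑ k(α)(1 -
σ_α)) Vp = ∑ x_i V(∂_i p). That this solution satisfies T_i V = V∂_i is a Poincaré lemma
(`polyDunkl_eq_of_eulerOp_eq`), proved by the maximum principle for vector fields. Commutativity of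
the T_i is not an input: it is carried over from the ∂_i by the surjectivity of V.

The same lower bound gives |K_n(x,z)| ≤ (|x||z|)^n/n!. The operators on functions may therefore be
applied term by term (`opPow_dunklOp_tsum`), within series of polynomials that are summable
uniformly on balls of ℂ^N. -/

/-- The linear form `⟨a, ·⟩` as a polynomial. -/
noncomputable def linForm {N : ℕ} (a : Space N) : Poly N :=
  ∑ i, MvPolynomial.C (a i : ℂ) * MvPolynomial.X i

/-- Composition with the reflection along a vector `a` with `|a|² = 2`. -/
noncomputable def polyRefl {N : ℕ} (a : Space N) : Poly N →ₐ[ℂ] Poly N :=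
  MvPolynomial.aeval (fun i => MvPolynomial.X i - MvPolynomial.C (a i : ℂ) * linForm a)

/-! ### Reflections and difference quotients on polynomials. -/

section
open MvPolynomial
variable {N : ℕ}

lemma polyRefl_X (a : Space N) (i : Fin N) :
    polyRefl a (X i) = X i - C (a i : ℂ) * linForm a := by
  simp [polyRefl]

lemma polyRefl_C (a : Space N) (c : ℂ) : polyRefl a (C c) = C c := by
  simp [polyRefl]

/-- The reflection moves each variable by a multiple of ⟨a, ·⟩, so it is the identity modulo that
form. -/
lemma linForm_dvd_sub_polyRefl (a : Space N) (p : Poly N) : linForm a ∣ p - polyRefl a p := by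
  induction p using MvPolynomial.induction_on with
  | C c => simp
  | add p q hp hq =>
    rw [map_add, add_sub_add_comm]
    exact dvd_add hp hq
  | mul_X p i hp =>
    have : p * X i - polyRefl a (p * X i) =
        (p - polyRefl a p) * X i + linForm a * (C (a i : ℂ) * polyRefl a p) := by
      rw [map_mul, polyRefl_X]; ring
    rw [this]
    exact dvd_add (hp.mul_right _) (dvd_mul_right _ _)

lemma linForm_ne_zero {a : Space N} (ha : a ≠ 0) : linForm a ≠ 0 := by
  intro h
  apply ha
  ext i
  have := congrArg (coeff (Finsupp.single i 1)) h
  simpa [linForm, coeff_sum, coeff_C_mul, coeff_X, Finsupp.single_left_inj] using this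

lemma exists_reflQuot_linearMap (a : Space N) :
    ∃ Q : Poly N →ₗ[ℂ] Poly N, ∀ p, linForm a * Q p = p - polyRefl a p := by
  -- The degenerate vector is included so that `polyQuot` is defined for every a; its reflection is
  -- the identity.
  by_cases ha : a = 0
  · subst ha
    refine ⟨0, fun p => ?_⟩
    have : polyRefl (0 : Space N) = AlgHom.id ℂ _ := by
      ext i; simp [polyRefl_X]
    simp [this]
  · have hl := linForm_ne_zero ha
    choose q hq using fun p => linForm_dvd_sub_polyRefl a p
    refine ⟨⟨⟨q, fun p r => mul_left_cancel₀ hl ?_⟩, fun c p => mul_left_cancel₀ hl ?_⟩,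
      fun p => (hq p).symm⟩
    · rw [mul_add, ← hq, ← hq, ← hq, map_add]; ring
    · simp only [RingHom.id_apply]
      rw [mul_smul_comm, ← hq, ← hq, map_smul, smul_sub]

/-- The difference quotient `(p - p ∘ σ_a) / ⟨a, ·⟩` on polynomials. -/
noncomputable def polyQuot {N : ℕ} (a : Space N) : Poly N →ₗ[ℂ] Poly N :=
  (exists_reflQuot_linearMap a).choose

lemma linForm_mul_polyQuot (a : Space N) (p : Poly N) :
    linForm a * polyQuot a p = p - polyRefl a p :=
  (exists_reflQuot_linearMap a).choose_spec p

lemma polyQuot_eq_of_mul_eq {a : Space N} (ha : a ≠ 0) {p q : Poly N}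
    (h : linForm a * q = p - polyRefl a p) : polyQuot a p = q :=
  mul_left_cancel₀ (linForm_ne_zero ha) ((linForm_mul_polyQuot a p).trans h.symm)

lemma polyQuot_X_mul {a : Space N} (ha : a ≠ 0) (i : Fin N) (p : Poly N) :
    polyQuot a (X i * p) = X i * polyQuot a p + C (a i : ℂ) * polyRefl a p := by
  apply polyQuot_eq_of_mul_eq ha
  rw [mul_add, mul_left_comm, linForm_mul_polyQuot, map_mul, polyRefl_X]; ring

lemma polyQuot_C {a : Space N} (ha : a ≠ 0) (c : ℂ) : polyQuot a (C c) = 0 := by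
  apply polyQuot_eq_of_mul_eq ha
  simp

lemma isHomogeneous_linForm (a : Space N) : (linForm a).IsHomogeneous 1 :=
  IsHomogeneous.sum _ _ _ fun i _ => isHomogeneous_C_mul_X _ i

lemma isHomogeneous_polyRefl (a : Space N) {n : ℕ} {p : Poly N} (hp : p.IsHomogeneous n) :
    (polyRefl a p).IsHomogeneous n := by
  have := hp.aeval (fun i => X i - C (a i : ℂ) * linForm a) (n := 1) fun i =>
    (isHomogeneous_X ℂ i).sub ((isHomogeneous_linForm a).C_mul _)
  rwa [one_mul] at this

lemma homogeneousComponent_mul {l : Poly N} {m : ℕ} (hl : l.IsHomogeneous m) (q : Poly N)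
    (j : ℕ) : homogeneousComponent (m + j) (l * q) = l * homogeneousComponent j q := by
  conv_lhs => rw [← sum_homogeneousComponent q, Finset.mul_sum, map_sum]
  by_cases hjq : j ∈ Finset.range (q.totalDegree + 1)
  · rw [Finset.sum_eq_single_of_mem j hjq]
    · exact homogeneousComponent_eq_self (hl.mul (homogeneousComponent_isHomogeneous j q))
    · intro b _ hb
      rw [homogeneousComponent_of_mem (hl.mul (homogeneousComponent_isHomogeneous b q)),
        if_neg (by omega)]
  · rw [Finset.sum_eq_zero, homogeneousComponent_eq_zero _ _ (by simpa using hjq), mul_zero]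
    intro b hb
    rw [homogeneousComponent_of_mem (hl.mul (homogeneousComponent_isHomogeneous b q)), if_neg]
    rintro h
    exact hjq (by rwa [show j = b by omega])

lemma isHomogeneous_of_mul_left {l q : Poly N} {m n : ℕ} (hl : l.IsHomogeneous m) (hl0 : l ≠ 0)
    (h : (l * q).IsHomogeneous (m + n)) : q.IsHomogeneous n := by
  have key : ∀ j, j ≠ n → homogeneousComponent j q = 0 := by
    intro j hj
    have h1 := homogeneousComponent_mul hl q j
    rw [homogeneousComponent_of_mem h, if_neg (by omega)] at h1
    exact (mul_eq_zero.mp h1.symm).resolve_left hl0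
  have : q = homogeneousComponent n q := by
    conv_lhs => rw [← sum_homogeneousComponent q]
    by_cases hn : n ∈ Finset.range (q.totalDegree + 1)
    · exact Finset.sum_eq_single_of_mem n hn fun b _ hb => key b hb
    · rw [homogeneousComponent_eq_zero _ _ (by simpa using hn)]
      exact Finset.sum_eq_zero fun b hb => key b fun h => hn (h ▸ hb)
  rw [this]
  exact homogeneousComponent_isHomogeneous n q

lemma eq_C_of_isHomogeneous_zero {p : Poly N} (hp : p.IsHomogeneous 0) :
    p = C (coeff 0 p) := by
  rw [← totalDegree_zero_iff_isHomogeneous, totalDegree_eq_zero_iff_eq_C] at hp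
  exact hp

lemma isHomogeneous_polyQuot {a : Space N} (ha : a ≠ 0) {n : ℕ} {p : Poly N}
    (hp : p.IsHomogeneous n) : (polyQuot a p).IsHomogeneous (n - 1) := by
  cases n with
  | zero =>
    rw [eq_C_of_isHomogeneous_zero hp, polyQuot_C ha]
    exact isHomogeneous_zero _ _ _
  | succ n =>
    refine isHomogeneous_of_mul_left (isHomogeneous_linForm a) (linForm_ne_zero ha) ?_
    rw [linForm_mul_polyQuot, Nat.add_sub_cancel, add_comm]
    exact hp.sub (isHomogeneous_polyRefl a hp)

/-! ### Dunkl operators on polynomials and the Euler operator. -/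

/-- The Dunkl operator `T_i` on polynomials. -/
noncomputable def polyDunkl {N : ℕ} (Rp : Finset (Space N)) (k : Space N → ℝ) (i : Fin N) :
    Poly N →ₗ[ℂ] Poly N :=
  (pderiv i).toLinearMap + ∑ α ∈ Rp, ((k α : ℂ) * (α i : ℂ)) • polyQuot α

variable {Rp : Finset (Space N)} {k : Space N → ℝ}

lemma polyDunkl_apply (i : Fin N) (p : Poly N) : polyDunkl Rp k i p =
    pderiv i p + ∑ α ∈ Rp, ((k α : ℂ) * (α i : ℂ)) • polyQuot α p := by
  simp [polyDunkl]

lemma ne_zero_of_norm_sq {a : Space N} (ha : ‖a‖ ^ 2 = 2) : a ≠ 0 := by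
  rintro rfl; simp at ha

lemma sum_sq_of_norm_sq {a : Space N} (ha : ‖a‖ ^ 2 = 2) : ∑ i, (a i : ℂ) * (a i : ℂ) = 2 := by
  rw [EuclideanSpace.real_norm_sq_eq] at ha
  exact_mod_cast (by simpa [sq] using ha : ∑ i, a i * a i = 2)

lemma polyDunkl_C (hRp : ∀ α ∈ Rp, ‖α‖ ^ 2 = 2) (i : Fin N) (c : ℂ) :
    polyDunkl Rp k i (C c) = 0 := by
  rw [polyDunkl_apply, pderiv_C, zero_add]
  exact Finset.sum_eq_zero fun α hα => by
    rw [polyQuot_C (ne_zero_of_norm_sq (hRp α hα)), smul_zero]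

lemma isHomogeneous_polyDunkl (hRp : ∀ α ∈ Rp, ‖α‖ ^ 2 = 2) (i : Fin N) {n : ℕ} {p : Poly N}
    (hp : p.IsHomogeneous n) : (polyDunkl Rp k i p).IsHomogeneous (n - 1) := by
  rw [polyDunkl_apply]
  refine hp.pderiv.add (IsHomogeneous.sum _ _ _ fun α hα => ?_)
  rw [smul_eq_C_mul]
  exact (isHomogeneous_polyQuot (ne_zero_of_norm_sq (hRp α hα)) hp).C_mul _

/-- `n + ∑ k(α) (1 - σ_α)`, the Dunkl form of the Euler operator in degree `n`. -/
noncomputable def eulerOp {N : ℕ} (Rp : Finset (Space N)) (k : Space N → ℝ) (n : ℕ) :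
    Poly N →ₗ[ℂ] Poly N :=
  (n : ℂ) • LinearMap.id + ∑ α ∈ Rp, (k α : ℂ) • (LinearMap.id - (polyRefl α).toLinearMap)

lemma eulerOp_apply (n : ℕ) (p : Poly N) : eulerOp Rp k n p =
    (n : ℂ) • p + ∑ α ∈ Rp, (k α : ℂ) • (p - polyRefl α p) := by
  simp [eulerOp]

lemma isHomogeneous_smul {p : Poly N} {n : ℕ} (hp : p.IsHomogeneous n) (c : ℂ) :
    (c • p).IsHomogeneous n := by
  rw [smul_eq_C_mul]; exact hp.C_mul _

lemma isHomogeneous_eulerOp (m : ℕ) {n : ℕ} {p : Poly N} (hp : p.IsHomogeneous n) :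
    (eulerOp Rp k m p).IsHomogeneous n := by
  rw [eulerOp_apply]
  exact (isHomogeneous_smul hp _).add (IsHomogeneous.sum _ _ _ fun α _ =>
    isHomogeneous_smul (hp.sub (isHomogeneous_polyRefl α hp)) _)

/-- Summing x_i α_i rebuilds ⟨α, x⟩ and cancels the denominator of the difference quotient; the
derivative part is Euler's identity. -/
lemma sum_X_mul_polyDunkl {n : ℕ} {p : Poly N} (hp : p.IsHomogeneous n) :
    ∑ i, X i * polyDunkl Rp k i p = eulerOp Rp k n p := by
  simp only [polyDunkl_apply, mul_add, Finset.sum_add_distrib, eulerOp_apply]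
  rw [hp.sum_X_mul_pderiv, Nat.cast_smul_eq_nsmul]
  congr 1
  simp only [Finset.mul_sum]
  rw [Finset.sum_comm]
  refine Finset.sum_congr rfl fun α _ => ?_
  rw [← linForm_mul_polyQuot, linForm, Finset.sum_mul, Finset.smul_sum]
  refine Finset.sum_congr rfl fun i _ => ?_
  simp only [smul_eq_C_mul, map_mul]; ring

lemma polyDunkl_X_mul (hRp : ∀ α ∈ Rp, ‖α‖ ^ 2 = 2) (i j : Fin N) (p : Poly N) :
    polyDunkl Rp k i (X j * p) = X j * polyDunkl Rp k i p + (if i = j then p else 0) +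
      ∑ α ∈ Rp, ((k α : ℂ) * (α i : ℂ) * (α j : ℂ)) • polyRefl α p := by
  classical
  simp only [polyDunkl_apply]
  have h : ∑ α ∈ Rp, ((k α : ℂ) * (α i : ℂ)) • polyQuot α (X j * p) =
      X j * ∑ α ∈ Rp, ((k α : ℂ) * (α i : ℂ)) • polyQuot α p +
      ∑ α ∈ Rp, ((k α : ℂ) * (α i : ℂ) * (α j : ℂ)) • polyRefl α p := by
    rw [Finset.mul_sum, ← Finset.sum_add_distrib]
    refine Finset.sum_congr rfl fun α hα => ?_
    rw [polyQuot_X_mul (ne_zero_of_norm_sq (hRp α hα))]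
    simp only [smul_eq_C_mul, map_mul]; ring
  rw [h, pderiv_mul, pderiv_X]
  by_cases hij : i = j
  · subst hij; simp; ring
  · simp [hij, Ne.symm hij]; ring

/-! ### Equivariance -/

lemma rootRefl_apply {a : Space N} (ha : ‖a‖ ^ 2 = 2) (x : Space N) :
    rootRefl a x = x - (inner ℝ a x : ℝ) • a := by
  rw [rootRefl, ha]; congr 2; ring

lemma linForm_smul_sub (c : ℝ) (a b : Space N) :
    linForm (b - c • a) = linForm b - C (c : ℂ) * linForm a := by
  simp only [linForm, Finset.mul_sum, ← Finset.sum_sub_distrib]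
  refine Finset.sum_congr rfl fun i _ => ?_
  simp; ring

lemma polyRefl_linForm {a : Space N} (ha : ‖a‖ ^ 2 = 2) (b : Space N) :
    polyRefl a (linForm b) = linForm (rootRefl a b) := by
  rw [rootRefl_apply ha, linForm_smul_sub]
  conv_lhs => rw [linForm, map_sum]
  simp only [map_mul, polyRefl_C, polyRefl_X, mul_sub, Finset.sum_sub_distrib]
  rw [← linForm]
  congr 1
  simp only [← mul_assoc, ← Finset.sum_mul]
  congr 1
  simp [PiLp.inner_apply]

lemma inner_rootRefl {a : Space N} (ha : ‖a‖ ^ 2 = 2) (x y : Space N) :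
    inner ℝ (rootRefl a x) (rootRefl a y) = (inner ℝ x y : ℝ) := by
  simp only [rootRefl_apply ha, inner_sub_left, inner_sub_right, real_inner_smul_left,
    real_inner_smul_right, real_inner_self_eq_norm_sq, ha]
  rw [real_inner_comm a x]; ring

lemma rootRefl_rootRefl {a : Space N} (ha : ‖a‖ ^ 2 = 2) (x : Space N) :
    rootRefl a (rootRefl a x) = x := by
  simp only [rootRefl_apply ha, inner_sub_right, real_inner_smul_right,
    real_inner_self_eq_norm_sq, ha]
  module

lemma inner_rootRefl_left {a : Space N} (ha : ‖a‖ ^ 2 = 2) (x y : Space N) :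
    inner ℝ (rootRefl a x) y = (inner ℝ x (rootRefl a y) : ℝ) := by
  conv_lhs => rw [← rootRefl_rootRefl ha y]
  exact inner_rootRefl ha _ _

lemma norm_rootRefl {a : Space N} (ha : ‖a‖ ^ 2 = 2) (x : Space N) : ‖rootRefl a x‖ = ‖x‖ := by
  rw [← sq_eq_sq₀ (norm_nonneg _) (norm_nonneg _), ← real_inner_self_eq_norm_sq,
    inner_rootRefl ha, real_inner_self_eq_norm_sq]

lemma rootRefl_self {a : Space N} (ha : ‖a‖ ^ 2 = 2) : rootRefl a a = -a := by
  rw [rootRefl_apply ha, real_inner_self_eq_norm_sq, ha]; module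

lemma rootRefl_neg (a x : Space N) : rootRefl a (-x) = -rootRefl a x := by
  simp [rootRefl]; module

lemma polyRefl_eq_of_linForm {f g : Poly N →ₐ[ℂ] Poly N}
    (h : ∀ a, f (linForm a) = g (linForm a)) : f = g := by
  ext1 i
  have hX : linForm (EuclideanSpace.single i (1 : ℝ) : Space N) = X i := by
    rw [linForm, Finset.sum_eq_single i] <;> simp +contextual
  rw [← hX]; exact h _

lemma polyRefl_polyRefl {a : Space N} (ha : ‖a‖ ^ 2 = 2) (p : Poly N) :
    polyRefl a (polyRefl a p) = p := by
  have : (polyRefl a).comp (polyRefl a) = AlgHom.id ℂ _ :=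
    polyRefl_eq_of_linForm fun b => by
      simp [polyRefl_linForm ha, rootRefl_rootRefl ha]
  simpa using DFunLike.congr_fun this p

/-- This is the conjugation rule for reflections: σ_b σ_a σ_b is the reflection along σ_b a. -/
lemma polyRefl_conj {a b : Space N} (ha : ‖a‖ ^ 2 = 2) (hb : ‖b‖ ^ 2 = 2) (p : Poly N) :
    polyRefl a (polyRefl b p) = polyRefl b (polyRefl (rootRefl b a) p) := by
  have hba : ‖rootRefl b a‖ ^ 2 = 2 := by rw [norm_rootRefl hb, ha]
  have : (polyRefl a).comp (polyRefl b) = (polyRefl b).comp (polyRefl (rootRefl b a)) :=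
    polyRefl_eq_of_linForm fun c => by
      simp only [AlgHom.comp_apply, polyRefl_linForm ha, polyRefl_linForm hb,
        polyRefl_linForm hba]
      congr 1
      rw [rootRefl_apply hba, rootRefl_apply ha, inner_rootRefl_left hb]
      have hlin : ∀ (t : ℝ) (u v : Space N),
          rootRefl b (u - t • v) = rootRefl b u - t • rootRefl b v := by
        intro t u v
        simp only [rootRefl_apply hb, inner_sub_right, real_inner_smul_right]
        module
      rw [hlin, rootRefl_rootRefl hb]
  simpa using DFunLike.congr_fun this p

lemma polyQuot_polyRefl {a b : Space N} (ha : ‖a‖ ^ 2 = 2) (hb : ‖b‖ ^ 2 = 2) (p : Poly N) :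
    polyQuot a (polyRefl b p) = polyRefl b (polyQuot (rootRefl b a) p) := by
  apply polyQuot_eq_of_mul_eq (ne_zero_of_norm_sq ha)
  have := congrArg (polyRefl b) (linForm_mul_polyQuot (rootRefl b a) p)
  rw [map_mul, polyRefl_linForm hb, rootRefl_rootRefl hb, map_sub] at this
  rw [this, polyRefl_conj ha hb]

lemma polyQuot_neg {a : Space N} (ha : a ≠ 0) (p : Poly N) :
    polyQuot (-a) p = -polyQuot a p := by
  have hl : linForm (-a) = -linForm a := by simp [linForm]
  have hr : polyRefl (-a) = polyRefl a := by
    ext1 i; simp [polyRefl_X, hl]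
  apply polyQuot_eq_of_mul_eq (neg_ne_zero.mpr ha)
  rw [hl, hr, neg_mul_neg, linForm_mul_polyQuot]

lemma pderiv_linForm (j : Fin N) (a : Space N) : pderiv j (linForm a) = C (a j : ℂ) := by
  classical
  simp [linForm, pderiv_X, Pi.single_apply]

lemma pderiv_polyRefl (a : Space N) (j : Fin N) (p : Poly N) :
    pderiv j (polyRefl a p) = polyRefl a (pderiv j p) -
      C (a j : ℂ) * polyRefl a (∑ i, C (a i : ℂ) * pderiv i p) := by
  classical
  induction p using MvPolynomial.induction_on with
  | C c => simp
  | add p q hp hq =>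
    simp only [map_add, hp, hq, mul_add, Finset.sum_add_distrib]; ring
  | mul_X p i hp =>
    have h : ∑ l, C (a l : ℂ) * pderiv l (p * X i) =
        X i * (∑ l, C (a l : ℂ) * pderiv l p) + C (a i : ℂ) * p := by
      simp only [pderiv_mul, pderiv_X, mul_add, Finset.sum_add_distrib, Finset.mul_sum]
      congr 1
      · exact Finset.sum_congr rfl fun l _ => by ring
      · rw [Finset.sum_eq_single i]
        · simp
        · intro b _ hb; simp [Ne.symm hb]
        · simp
    rw [h, map_mul, pderiv_mul, hp, polyRefl_X, pderiv_mul]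
    simp only [map_add, map_mul, map_sub, polyRefl_X, polyRefl_C, pderiv_C_mul, pderiv_linForm,
      pderiv_X]
    by_cases hij : j = i
    · subst hij; simp; ring
    · simp [Ne.symm hij]; ring

/-- The transformation rule of the Dunkl operators under the reflections in the positive roots. -/
def DunklEquivariant {N : ℕ} (Rp : Finset (Space N)) (k : Space N → ℝ) : Prop :=
  ∀ b ∈ Rp, ∀ (j : Fin N) (p : Poly N), polyDunkl Rp k j (polyRefl b p) =
    polyRefl b (polyDunkl Rp k j p - (b j : ℂ) • ∑ i, (b i : ℂ) • polyDunkl Rp k i p)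

end

end Dunkl

namespace Dunkl

section
open MvPolynomial
variable {N : ℕ}

/-! ### Root systems -/

lemma IsNormalizedRootSystem.norm_sq {R : Finset (Space N)} (hR : IsNormalizedRootSystem R)
    {α : Space N} (hα : α ∈ R) : ‖α‖ ^ 2 = 2 := by
  rw [hR.norm_eq α hα]; norm_num

lemma IsNormalizedRootSystem.neg_mem {R : Finset (Space N)} (hR : IsNormalizedRootSystem R)
    {α : Space N} (hα : α ∈ R) : -α ∈ R := by
  have : -α ∈ (R : Set (Space N)) ∩ {v | ∃ c : ℝ, v = c • α} := by
    rw [hR.inter_line α hα]; simp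
  exact this.1

lemma IsNormalizedRootSystem.rootRefl_mem {R : Finset (Space N)} (hR : IsNormalizedRootSystem R)
    {α b : Space N} (hα : α ∈ R) (hb : b ∈ R) : rootRefl b α ∈ R := by
  have : rootRefl b α ∈ rootRefl b '' (R : Set (Space N)) := ⟨α, hα, rfl⟩
  rw [hR.refl_image b hb] at this
  exact this

lemma sum_eq_two_smul_sum_posRoots {M : Type*} [AddCommGroup M] {R : Finset (Space N)}
    (hR : IsNormalizedRootSystem R) {β : Space N} (hβ : ∀ α ∈ R, inner ℝ α β ≠ (0 : ℝ))
    (h : Space N → M) (heven : ∀ α ∈ R, h (-α) = h α) :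
    ∑ α ∈ R, h α = 2 • ∑ α ∈ posRoots R β, h α := by
  classical
  rw [← Finset.sum_filter_add_sum_filter_not R (fun α => 0 < inner ℝ α β), two_smul, posRoots]
  congr 1
  refine Finset.sum_nbij' (fun α => -α) (fun α => -α) ?_ ?_ (by simp) (by simp) ?_
  · intro α hα
    rw [Finset.mem_filter] at hα ⊢
    refine ⟨hR.neg_mem hα.1, ?_⟩
    rw [inner_neg_left]
    have := lt_of_le_of_ne (not_lt.mp hα.2) (hβ α hα.1)
    linarith
  · intro α hα
    rw [Finset.mem_filter] at hα ⊢
    refine ⟨hR.neg_mem hα.1, ?_⟩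
    rw [inner_neg_left]
    linarith [hα.2]
  · intro α hα
    exact (heven α (Finset.mem_filter.mp hα).1).symm

lemma IsMultiplicity.neg {R : Finset (Space N)} (hR : IsNormalizedRootSystem R)
    {k : Space N → ℝ} (hk : IsMultiplicity R k) {α : Space N} (hα : α ∈ R) : k (-α) = k α := by
  rw [← rootRefl_self (hR.norm_sq hα)]
  exact hk.invariant α hα α hα

/-- A reflection need not preserve the positive roots, but it permutes R, and for an even summand
the sum over the positive roots is half the sum over R. The rational structure on M allows the
division by 2. -/
lemma sum_posRoots_rootRefl {M : Type*} [AddCommGroup M] [Module ℚ M]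
    {R : Finset (Space N)}
    (hR : IsNormalizedRootSystem R) {β : Space N} (hβ : ∀ α ∈ R, inner ℝ α β ≠ (0 : ℝ))
    (h : Space N → M) (heven : ∀ α ∈ R, h (-α) = h α) {b : Space N} (hb : b ∈ R) :
    ∑ α ∈ posRoots R β, h (rootRefl b α) = ∑ α ∈ posRoots R β, h α := by
  have h1 := sum_eq_two_smul_sum_posRoots hR hβ h heven
  have h2 := sum_eq_two_smul_sum_posRoots hR hβ (fun α => h (rootRefl b α)) fun α hα => by
    rw [rootRefl_neg]; exact heven _ (hR.rootRefl_mem hα hb)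
  have h3 : ∑ α ∈ R, h (rootRefl b α) = ∑ α ∈ R, h α :=
    Finset.sum_nbij' (rootRefl b) (rootRefl b) (fun α hα => hR.rootRefl_mem hα hb)
      (fun α hα => hR.rootRefl_mem hα hb) (fun α _ => rootRefl_rootRefl (hR.norm_sq hb) α)
      (fun α _ => rootRefl_rootRefl (hR.norm_sq hb) α) (fun _ _ => rfl)
  rw [h1, h2] at h3
  have h4 := congrArg (fun m => (2⁻¹ : ℚ) • m) h3
  simpa only [← Nat.cast_smul_eq_nsmul ℚ, smul_smul, Nat.cast_ofNat,
    inv_mul_cancel₀ (two_ne_zero' ℚ), one_smul] using h4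

lemma norm_sq_of_mem_posRoots {R : Finset (Space N)} (hR : IsNormalizedRootSystem R)
    (β : Space N) : ∀ α ∈ posRoots R β, ‖α‖ ^ 2 = 2 :=
  fun _ hα => hR.norm_sq (Finset.mem_filter.mp hα).1

/-- The term k(α) α_j (p - σ_α p)/⟨α, ·⟩ is even in α, so `sum_posRoots_rootRefl` permits the change
of index α ↦ σ_b α; the derivative part is the chain rule. -/
lemma IsNormalizedRootSystem.dunklEquivariant {R : Finset (Space N)}
    (hR : IsNormalizedRootSystem R) {β : Space N} (hβ : ∀ α ∈ R, inner ℝ α β ≠ (0 : ℝ))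
    {k : Space N → ℝ} (hk : IsMultiplicity R k) : DunklEquivariant (posRoots R β) k := by
  intro b hb j p
  have hbR : b ∈ R := (Finset.mem_filter.mp hb).1
  have hb2 := hR.norm_sq hbR
  have hin : ∀ α : Space N, ∑ i, (b i : ℂ) * (α i : ℂ) = ((inner ℝ b α : ℝ) : ℂ) := by
    intro α
    simp [PiLp.inner_apply, mul_comm]
  have h1 : ∑ α ∈ posRoots R β, ((k α : ℂ) * (α j : ℂ)) • polyQuot α (polyRefl b p) =
      polyRefl b (∑ α ∈ posRoots R β,
        ((k α : ℂ) * ((rootRefl b α) j : ℂ)) • polyQuot α p) := by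
    rw [← sum_posRoots_rootRefl hR hβ
      (fun α => ((k α : ℂ) * ((rootRefl b α) j : ℂ)) • polyQuot α p) _ hbR, map_sum]
    · refine Finset.sum_congr rfl fun α hα => ?_
      have hαR : α ∈ R := (Finset.mem_filter.mp hα).1
      rw [polyQuot_polyRefl (hR.norm_sq hαR) hb2, rootRefl_rootRefl hb2,
        hk.invariant α hαR b hbR, map_smul]
    · intro α hα
      rw [hk.neg hR hα, rootRefl_neg, polyQuot_neg (ne_zero_of_norm_sq (hR.norm_sq hα))]
      simp
  rw [polyDunkl_apply, h1, pderiv_polyRefl, ← polyRefl_C b, ← map_mul, ← map_sub, ← map_add]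
  congr 1
  simp only [polyDunkl_apply, smul_add, Finset.sum_add_distrib, Finset.smul_sum, smul_smul]
  rw [Finset.sum_comm (s := Finset.univ), add_sub_add_comm, ← Finset.sum_sub_distrib]
  congr 1
  · simp only [Finset.mul_sum, smul_eq_C_mul, map_mul, mul_assoc]
  · refine Finset.sum_congr rfl fun α _ => ?_
    rw [← Finset.sum_smul, ← sub_smul]
    congr 1
    rw [rootRefl_apply hb2]
    push_cast [PiLp.sub_apply, PiLp.smul_apply, smul_eq_mul]
    rw [← hin, Finset.sum_mul, mul_sub, Finset.mul_sum]
    congr 1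
    exact Finset.sum_congr rfl fun i _ => by ring

/-! ### Evaluation at complex points -/

/-- The complexification of `ℝ^N`. -/
abbrev CSpace (N : ℕ) : Type := EuclideanSpace ℂ (Fin N)

/-- The complex-linear extension of the reflection along a vector `a` with `|a|² = 2`. -/
noncomputable def cRefl (a : Space N) (x : CSpace N) : CSpace N :=
  WithLp.toLp 2 fun i => x i - (a i : ℂ) * ∑ j, (a j : ℂ) * x j

/-- Evaluation of a polynomial at a complex point. -/
noncomputable def cEval (x : CSpace N) : Poly N →ₐ[ℂ] ℂ := MvPolynomial.aeval fun i => x i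

lemma cEval_X (x : CSpace N) (i : Fin N) : cEval x (X i) = x i := by simp [cEval]

lemma cEval_C (x : CSpace N) (c : ℂ) : cEval x (C c) = c := by simp [cEval]

lemma cEval_linForm (x : CSpace N) (a : Space N) :
    cEval x (linForm a) = ∑ j, (a j : ℂ) * x j := by
  simp [linForm, cEval_X]

lemma cEval_polyRefl (a : Space N) (x : CSpace N) (p : Poly N) :
    cEval x (polyRefl a p) = cEval (cRefl a x) p := by
  have : (cEval x).comp (polyRefl a) = cEval (cRefl a x) := by
    ext i
    simp [polyRefl_X, cEval_X, cEval_linForm, cRefl]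
  exact DFunLike.congr_fun this p

lemma continuous_cEval (p : Poly N) : Continuous fun x : CSpace N => cEval x p := by
  induction p using MvPolynomial.induction_on with
  | C c => simp only [cEval_C]; fun_prop
  | add p q hp hq => simp only [map_add]; fun_prop
  | mul_X p i hp => simp only [map_mul, cEval_X]; fun_prop

lemma eq_zero_of_cEval {p : Poly N} (h : ∀ x, cEval x p = 0) : p = 0 := by
  apply MvPolynomial.funext
  intro x
  simpa [cEval, coe_aeval_eq_eval] using h (WithLp.toLp 2 x)

/-- As a is real, the complexified reflection is unitary, so the maximum principle is available on
complex balls. -/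
lemma norm_cRefl {a : Space N} (ha : ‖a‖ ^ 2 = 2) (x : CSpace N) : ‖cRefl a x‖ = ‖x‖ := by
  rw [← sq_eq_sq₀ (norm_nonneg _) (norm_nonneg _), EuclideanSpace.norm_sq_eq,
    EuclideanSpace.norm_sq_eq]
  have hc : ∀ z : ℂ, ((‖z‖ ^ 2 : ℝ) : ℂ) = z * (starRingEnd ℂ) z := fun z => by
    rw [Complex.mul_conj, Complex.normSq_eq_norm_sq]
  have h2 := sum_sq_of_norm_sq ha
  set s := ∑ j, (a j : ℂ) * x j with hs
  have hs' : ∑ j, (a j : ℂ) * (starRingEnd ℂ) (x j) = (starRingEnd ℂ) s := by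
    rw [hs, map_sum]; simp
  apply Complex.ofReal_injective
  push_cast
  simp only [← Complex.ofReal_pow, hc]
  have : ∀ i, (cRefl a x) i * (starRingEnd ℂ) ((cRefl a x) i) =
      x i * (starRingEnd ℂ) (x i) - s * ((a i : ℂ) * (starRingEnd ℂ) (x i)) -
      (starRingEnd ℂ) s * ((a i : ℂ) * x i) + s * (starRingEnd ℂ) s * ((a i : ℂ) * (a i : ℂ)) := by
    intro i
    simp only [cRefl, ← hs, map_sub, map_mul, Complex.conj_ofReal]; ring
  simp only [this, Finset.sum_add_distrib, Finset.sum_sub_distrib, ← Finset.mul_sum, h2, ← hs, hs']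
  ring

/-! ### The maximum principle -/

/-- At a maximum point of |f| on S, the values f(τ_i x) are no larger than |f(x)| and the weights
c_i are non-negative, so the terms with c_i cancel from the estimate and only m is left. -/
lemma mul_norm_le_of_average {X ι : Type*} [TopologicalSpace X] {S : Set X} (hS : IsCompact S)
    (s : Finset ι) {c : ι → ℝ} (hc : ∀ i ∈ s, 0 ≤ c i) {τ : ι → X → X}
    (hτ : ∀ i ∈ s, Set.MapsTo (τ i) S S) {f g : X → ℂ} (hf : ContinuousOn f S) {m G : ℝ}
    (hm : 0 ≤ m) (hg : ∀ x ∈ S, ‖g x‖ ≤ G)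
    (h : ∀ x ∈ S, ((m : ℂ) + ∑ i ∈ s, (c i : ℂ)) * f x = ∑ i ∈ s, (c i : ℂ) * f (τ i x) + g x) :
    ∀ x ∈ S, m * ‖f x‖ ≤ G := by
  intro x hx
  obtain ⟨x₀, hx₀, hmax⟩ := hS.exists_isMaxOn ⟨x, hx⟩ hf.norm
  have hmax' : ∀ y ∈ S, ‖f y‖ ≤ ‖f x₀‖ := fun y hy => hmax hy
  have h1 : (m + ∑ i ∈ s, c i) * ‖f x₀‖ ≤ (∑ i ∈ s, c i) * ‖f x₀‖ + G := by
    have hpos : 0 ≤ m + ∑ i ∈ s, c i := add_nonneg hm (Finset.sum_nonneg hc)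
    calc (m + ∑ i ∈ s, c i) * ‖f x₀‖
        = ‖((m : ℂ) + ∑ i ∈ s, (c i : ℂ)) * f x₀‖ := by
          rw [norm_mul, ← Complex.ofReal_sum, ← Complex.ofReal_add, Complex.norm_real,
            Real.norm_of_nonneg hpos]
      _ ≤ ∑ i ∈ s, ‖(c i : ℂ) * f (τ i x₀)‖ + ‖g x₀‖ := by
          rw [h x₀ hx₀]
          exact (norm_add_le _ _).trans (add_le_add_left (norm_sum_le _ _) _)
      _ ≤ ∑ i ∈ s, c i * ‖f x₀‖ + G := by
          refine add_le_add (Finset.sum_le_sum fun i hi => ?_) (hg x₀ hx₀)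
          rw [norm_mul, Complex.norm_real, Real.norm_of_nonneg (hc i hi)]
          exact mul_le_mul_of_nonneg_left (hmax' _ (hτ i hi hx₀)) (hc i hi)
      _ = _ := by rw [Finset.sum_mul]
  calc m * ‖f x‖ ≤ m * ‖f x₀‖ := mul_le_mul_of_nonneg_left (hmax' x hx) hm
    _ ≤ G := by linarith

variable {Rp : Finset (Space N)} {k : Space N → ℝ}

lemma cEval_eulerOp (n : ℕ) (p : Poly N) (x : CSpace N) :
    ((n : ℝ) + ∑ α ∈ Rp, (k α : ℂ)) * cEval x p =
      ∑ α ∈ Rp, (k α : ℂ) * cEval (cRefl α x) p + cEval x (eulerOp Rp k n p) := by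
  simp only [eulerOp_apply, map_add, map_sum, map_smul, map_sub, cEval_polyRefl, smul_eq_mul,
    mul_sub, Finset.sum_sub_distrib, ← Finset.sum_mul]
  push_cast
  ring

/-- The Euler operator of degree `n` is bounded below by `n` for the sup norm on balls. -/
lemma mul_norm_cEval_le (hRp : ∀ α ∈ Rp, ‖α‖ ^ 2 = 2) (hk : ∀ α ∈ Rp, 0 ≤ k α) (n : ℕ)
    {p : Poly N} {r G : ℝ}
    (h : ∀ x : CSpace N, ‖x‖ ≤ r → ‖cEval x (eulerOp Rp k n p)‖ ≤ G) :
    ∀ x : CSpace N, ‖x‖ ≤ r → n * ‖cEval x p‖ ≤ G := by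
  intro x hx
  refine mul_norm_le_of_average (S := Metric.closedBall (0 : CSpace N) r)
    (isCompact_closedBall _ _) Rp hk (τ := cRefl) ?_ (continuous_cEval p).continuousOn
    (Nat.cast_nonneg n) (fun y hy => h y (by simpa using hy))
    (fun y _ => cEval_eulerOp n p y) x (by simpa using hx)
  intro α hα y hy
  simpa [norm_cRefl (hRp α hα)] using hy

lemma eulerOp_injective (hRp : ∀ α ∈ Rp, ‖α‖ ^ 2 = 2) (hk : ∀ α ∈ Rp, 0 ≤ k α) {n : ℕ}
    (hn : n ≠ 0) {p : Poly N} (h : eulerOp Rp k n p = 0) : p = 0 := by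
  refine eq_zero_of_cEval fun x => ?_
  have := mul_norm_cEval_le hRp hk n (p := p) (r := ‖x‖) (G := 0) (by simp [h]) x le_rfl
  have hn' : (0 : ℝ) < n := by exact_mod_cast Nat.pos_of_ne_zero hn
  exact norm_le_zero_iff.mp (by nlinarith [norm_nonneg (cEval x p)])

lemma eq_zero_of_vector_eulerOp (hRp : ∀ α ∈ Rp, ‖α‖ ^ 2 = 2) (hk : ∀ α ∈ Rp, 0 ≤ k α) {n : ℕ}
    (hn : n ≠ 0) {w : Fin N → Poly N}
    (h : ∀ j, (n : ℂ) • w j + ∑ α ∈ Rp, (k α : ℂ) •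
      (w j - polyRefl α (w j - (α j : ℂ) • ∑ i, (α i : ℂ) • w i)) = 0) : w = 0 := by
  -- Pairing w with an auxiliary vector ξ makes the system scalar: the reflections act diagonally on
  -- (x, ξ), and f satisfies the averaging identity with zero remainder on a product of balls.
  let f : CSpace N × CSpace N → ℂ := fun y => ∑ j, y.2 j * cEval y.1 (w j)
  have hf : Continuous f := by
    refine continuous_finsetSum _ fun j _ => ?_
    exact Continuous.mul (by fun_prop) ((continuous_cEval (w j)).comp continuous_fst)
  have hrel : ∀ y, (((n : ℝ) : ℂ) + ∑ α ∈ Rp, (k α : ℂ)) * f y =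
      ∑ α ∈ Rp, (k α : ℂ) * f (Prod.map (cRefl α) (cRefl α) y) + 0 := by
    intro y
    have hα : ∀ α : Space N, f (Prod.map (cRefl α) (cRefl α) y) = ∑ j, y.2 j *
        cEval y.1 (polyRefl α (w j - (α j : ℂ) • ∑ i, (α i : ℂ) • w i)) := by
      intro α
      simp only [f, Prod.map_fst, Prod.map_snd, cEval_polyRefl, map_sub, map_smul, map_sum,
        smul_eq_mul, mul_sub, Finset.sum_sub_distrib]
      simp only [cRefl, sub_mul, Finset.sum_sub_distrib]
      congr 1
      simp only [Finset.mul_sum, Finset.sum_mul]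
      rw [Finset.sum_comm]
      exact Finset.sum_congr rfl fun i _ => Finset.sum_congr rfl fun j _ => by ring
    have hsum : ∑ j, y.2 j * cEval y.1 ((n : ℂ) • w j + ∑ α ∈ Rp, (k α : ℂ) •
        (w j - polyRefl α (w j - (α j : ℂ) • ∑ i, (α i : ℂ) • w i))) = 0 :=
      Finset.sum_eq_zero fun j _ => by rw [h j, map_zero, mul_zero]
    have hexp : ∑ j, y.2 j * cEval y.1 ((n : ℂ) • w j + ∑ α ∈ Rp, (k α : ℂ) •
        (w j - polyRefl α (w j - (α j : ℂ) • ∑ i, (α i : ℂ) • w i))) =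
        n * f y + ∑ α ∈ Rp, (k α : ℂ) * (f y - f (Prod.map (cRefl α) (cRefl α) y)) := by
      simp only [hα]
      simp only [map_add, map_sum, map_smul, map_sub (cEval y.1), smul_eq_mul, mul_add,
        Finset.sum_add_distrib, f]
      congr 1
      · rw [Finset.mul_sum]; exact Finset.sum_congr rfl fun j _ => by ring
      · simp only [← Finset.sum_sub_distrib, Finset.mul_sum]
        rw [Finset.sum_comm]
        exact Finset.sum_congr rfl fun i _ => Finset.sum_congr rfl fun j _ => by ring
    rw [hexp] at hsum
    simp only [mul_sub, Finset.sum_sub_distrib, ← Finset.sum_mul] at hsum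
    push_cast
    linear_combination hsum
  funext j
  refine eq_zero_of_cEval fun x => ?_
  have hmem : (x, (EuclideanSpace.single j 1 : CSpace N)) ∈
      Metric.closedBall (0 : CSpace N) ‖x‖ ×ˢ Metric.closedBall (0 : CSpace N) 1 := by simp
  have := mul_norm_le_of_average ((isCompact_closedBall (0 : CSpace N) ‖x‖).prod
    (isCompact_closedBall (0 : CSpace N) 1)) Rp hk (τ := fun α => Prod.map (cRefl α) (cRefl α))
    (by
      intro α hα y hy
      simpa [norm_cRefl (hRp α hα)] using hy) hf.continuousOn (Nat.cast_nonneg n) (G := 0)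
    (g := fun _ => 0) (by simp) (fun y _ => hrel y) _ hmem
  have hfx : f (x, EuclideanSpace.single j 1) = cEval x (w j) := by
    simp [f]
  rw [hfx] at this
  have hn' : (0 : ℝ) < n := by exact_mod_cast Nat.pos_of_ne_zero hn
  exact norm_le_zero_iff.mp (by nlinarith [norm_nonneg (cEval x (w j))])

end

end Dunkl

/-! ### Existence and uniqueness of the intertwining operator. -/

namespace Dunkl

section
open MvPolynomial
variable {N : ℕ} {Rp : Finset (Space N)} {k : Space N → ℝ}

lemma pderiv_pderiv_comm (i j : Fin N) (p : Poly N) :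
    pderiv i (pderiv j p) = pderiv j (pderiv i p) := by
  classical
  induction p using MvPolynomial.induction_on with
  | C c => simp
  | add p q hp hq => simp [hp, hq]
  | mul_X p l hp =>
    have h : ∀ a b : Fin N, pderiv a (pderiv b (X l : Poly N)) = 0 := by
      intro a b
      by_cases hl : l = b
      · subst hl; simp
      · rw [pderiv_X_of_ne hl, map_zero]
    simp only [pderiv_mul, map_add, hp, h]
    ring

lemma finite_homogeneousSubmodule (n : ℕ) :
    Module.Finite ℂ (homogeneousSubmodule (Fin N) ℂ n) :=
  Module.Finite.iff_fg.mpr (homogeneousSubmodule_fg _ _ n)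

/-- An injective graded endomorphism maps the homogeneous polynomials of a degree onto
themselves. -/
lemma map_homogeneousSubmodule_eq {V : Poly N →ₗ[ℂ] Poly N} {n : ℕ}
    (hV : ∀ p : Poly N, p.IsHomogeneous n → (V p).IsHomogeneous n)
    (hinj : ∀ p : Poly N, p.IsHomogeneous n → V p = 0 → p = 0) :
    (homogeneousSubmodule (Fin N) ℂ n).map V = homogeneousSubmodule (Fin N) ℂ n := by
  have := finite_homogeneousSubmodule (N := N) n
  let f : homogeneousSubmodule (Fin N) ℂ n →ₗ[ℂ] homogeneousSubmodule (Fin N) ℂ n :=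
    V.restrict (p := homogeneousSubmodule (Fin N) ℂ n) (q := homogeneousSubmodule (Fin N) ℂ n)
      fun p hp => hV p hp
  have hf : Function.Injective f := by
    rw [← LinearMap.ker_eq_bot, LinearMap.ker_eq_bot']
    intro p hp
    exact Subtype.ext (hinj p p.2 (congrArg Subtype.val hp))
  refine le_antisymm ?_ ?_
  · rintro _ ⟨p, hp, rfl⟩
    exact hV p hp
  · intro q hq
    obtain ⟨p, hp⟩ := LinearMap.injective_iff_surjective.mp hf ⟨q, hq⟩
    exact ⟨p, p.2, congrArg Subtype.val hp⟩

lemma exists_eulerOp_inverse (hRp : ∀ α ∈ Rp, ‖α‖ ^ 2 = 2) (hk : ∀ α ∈ Rp, 0 ≤ k α) {n : ℕ}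
    (hn : n ≠ 0) : ∃ A : Poly N →ₗ[ℂ] Poly N, ∀ p : Poly N, p.IsHomogeneous n →
      (A p).IsHomogeneous n ∧ eulerOp Rp k n (A p) = p := by
  have hsurj := map_homogeneousSubmodule_eq (V := eulerOp Rp k n) (n := n)
    (fun p hp => isHomogeneous_eulerOp n hp) (fun p _ h => eulerOp_injective hRp hk hn h)
  let f : homogeneousSubmodule (Fin N) ℂ n →ₗ[ℂ] homogeneousSubmodule (Fin N) ℂ n :=
    (eulerOp Rp k n).restrict (p := homogeneousSubmodule (Fin N) ℂ n)
      (q := homogeneousSubmodule (Fin N) ℂ n) fun p hp => isHomogeneous_eulerOp n hp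
  have hf : LinearMap.range f = ⊤ := by
    rw [LinearMap.range_eq_top]
    rintro ⟨q, hq⟩
    obtain ⟨p, hp, hpq⟩ := hsurj.ge hq
    exact ⟨⟨p, hp⟩, Subtype.ext hpq⟩
  obtain ⟨g, hg⟩ := f.exists_rightInverse_of_surjective hf
  obtain ⟨A, hA⟩ := LinearMap.exists_extend ((homogeneousSubmodule (Fin N) ℂ n).subtype ∘ₗ g)
  refine ⟨A, fun p hp => ?_⟩
  have hAp : A p = g ⟨p, hp⟩ := LinearMap.congr_fun hA ⟨p, hp⟩
  rw [hAp]
  exact ⟨(g ⟨p, hp⟩).2, congrArg Subtype.val (LinearMap.congr_fun hg ⟨p, hp⟩)⟩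

/-- The intertwining property on polynomials, without surjectivity. -/
structure PolyIntertwining {N : ℕ} (Rp : Finset (Space N)) (k : Space N → ℝ)
    (V : Poly N →ₗ[ℂ] Poly N) : Prop where
  isHomogeneous : ∀ (n : ℕ) (p : Poly N), p.IsHomogeneous n → (V p).IsHomogeneous n
  map_C : ∀ c : ℂ, V (C c) = C c
  intertwines : ∀ (i : Fin N) (p : Poly N), polyDunkl Rp k i (V p) = V (pderiv i p)

lemma polyDunkl_eulerOp (he : DunklEquivariant Rp k) (n : ℕ) (j : Fin N) (p : Poly N) :
    polyDunkl Rp k j (eulerOp Rp k n p) = (n : ℂ) • polyDunkl Rp k j p +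
      ∑ α ∈ Rp, (k α : ℂ) • (polyDunkl Rp k j p - polyRefl α (polyDunkl Rp k j p -
        (α j : ℂ) • ∑ i, (α i : ℂ) • polyDunkl Rp k i p)) := by
  rw [eulerOp_apply, map_add, map_smul, map_sum]
  congr 1
  refine Finset.sum_congr rfl fun α hα => ?_
  rw [map_smul, map_sub, he α hα]

/-- A Poincaré lemma: closed data (q_j) has the potential u. Applying T_j to the equation for u
shows that (T_j u) and (q_j) solve the same vector equation, whose solution is unique by
`eq_zero_of_vector_eulerOp`. Commutativity of the T_i is not used, only closedness of the q_j. -/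
lemma polyDunkl_eq_of_eulerOp_eq (hRp : ∀ α ∈ Rp, ‖α‖ ^ 2 = 2) (hk : ∀ α ∈ Rp, 0 ≤ k α)
    (he : DunklEquivariant Rp k) {n : ℕ} {u : Poly N} {q : Fin N → Poly N}
    (hq : ∀ i, (q i).IsHomogeneous n)
    (hcomm : ∀ i j, polyDunkl Rp k i (q j) = polyDunkl Rp k j (q i))
    (hu : eulerOp Rp k (n + 1) u = ∑ i, X i * q i) (j : Fin N) :
    polyDunkl Rp k j u = q j := by
  suffices h : (fun j => polyDunkl Rp k j u - q j) = 0 from sub_eq_zero.mp (congrFun h j)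
  refine eq_zero_of_vector_eulerOp hRp hk (Nat.succ_ne_zero n) fun j => ?_
  have h1 := polyDunkl_eulerOp he (n + 1) j u
  -- Closedness replaces T_j q_i by T_i q_j, so the Euler operator of degree n appears; the
  -- commutator of T_j with x_i adds q_j, which raises n to n + 1, and the reflection terms.
  have h2 : polyDunkl Rp k j (∑ i, X i * q i) = eulerOp Rp k n (q j) + q j +
      ∑ α ∈ Rp, (k α : ℂ) • polyRefl α ((α j : ℂ) • ∑ i, (α i : ℂ) • q i) := by
    rw [map_sum]
    simp only [polyDunkl_X_mul hRp, Finset.sum_add_distrib, hcomm j]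
    rw [sum_X_mul_polyDunkl (hq j), Finset.sum_ite_eq, if_pos (Finset.mem_univ j)]
    congr 1
    rw [Finset.sum_comm]
    refine Finset.sum_congr rfl fun α _ => ?_
    simp only [map_smul, map_sum, Finset.smul_sum, smul_smul, mul_assoc]
  rw [hu, h2, eulerOp_apply] at h1
  have h3 : (n : ℂ) • q j + ∑ α ∈ Rp, (k α : ℂ) • (q j - polyRefl α (q j)) + q j +
      ∑ α ∈ Rp, (k α : ℂ) • polyRefl α ((α j : ℂ) • ∑ i, (α i : ℂ) • q i) =
      ((n + 1 : ℕ) : ℂ) • q j + ∑ α ∈ Rp, (k α : ℂ) •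
        (q j - polyRefl α (q j - (α j : ℂ) • ∑ i, (α i : ℂ) • q i)) := by
    have h4 : ∑ α ∈ Rp, (k α : ℂ) •
        (q j - polyRefl α (q j - (α j : ℂ) • ∑ i, (α i : ℂ) • q i)) =
        ∑ α ∈ Rp, (k α : ℂ) • (q j - polyRefl α (q j)) +
        ∑ α ∈ Rp, (k α : ℂ) • polyRefl α ((α j : ℂ) • ∑ i, (α i : ℂ) • q i) := by
      rw [← Finset.sum_add_distrib]
      refine Finset.sum_congr rfl fun α _ => ?_
      rw [map_sub]
      module
    rw [h4]
    push_cast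
    module
  rw [h3] at h1
  rw [← sub_eq_zero.mpr h1.symm, add_sub_add_comm, ← smul_sub, ← Finset.sum_sub_distrib]
  congr 1
  refine Finset.sum_congr rfl fun α _ => ?_
  rw [← smul_sub, sub_sub_sub_comm, ← map_sub]
  congr 3
  simp only [smul_sub, Finset.sum_sub_distrib]
  abel

lemma exists_polyIntertwining (hRp : ∀ α ∈ Rp, ‖α‖ ^ 2 = 2) (hk : ∀ α ∈ Rp, 0 ≤ k α)
    (he : DunklEquivariant Rp k) : ∃ V, PolyIntertwining Rp k V := by
  choose A hA using fun n : ℕ => exists_eulerOp_inverse (n := n + 1) hRp hk n.succ_ne_zero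
  -- W n is meaningful only in degree n. The index n - 1 in `key` is harmless at n = 0, where both
  -- sides vanish.
  let W : ℕ → (Poly N →ₗ[ℂ] Poly N) := fun n => Nat.rec LinearMap.id (fun n f =>
    A n ∘ₗ ∑ i, LinearMap.mulLeft ℂ (X i) ∘ₗ f ∘ₗ (pderiv i).toLinearMap) n
  have hW : ∀ n p, W (n + 1) p = A n (∑ i, X i * W n (pderiv i p)) := by
    intro n p
    simp [W]
  have key : ∀ n, ∀ p : Poly N, p.IsHomogeneous n → (W n p).IsHomogeneous n ∧
      ∀ i, polyDunkl Rp k i (W n p) = W (n - 1) (pderiv i p) := by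
    intro n
    induction n with
    | zero =>
      intro p hp
      refine ⟨hp, fun i => ?_⟩
      rw [eq_C_of_isHomogeneous_zero hp]
      simp [W, polyDunkl_C hRp]
    | succ n ih =>
      intro p hp
      have hd : ∀ i, (pderiv i p).IsHomogeneous n := fun i => hp.pderiv
      have hq : ∀ i, (W n (pderiv i p)).IsHomogeneous n := fun i => (ih _ (hd i)).1
      have hs : (∑ i, X i * W n (pderiv i p)).IsHomogeneous (n + 1) :=
        IsHomogeneous.sum _ _ _ fun i _ => by
          rw [add_comm]; exact (isHomogeneous_X ℂ i).mul (hq i)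
      rw [hW]
      refine ⟨(hA n _ hs).1, polyDunkl_eq_of_eulerOp_eq hRp hk he hq (fun i j => ?_) (hA n _ hs).2⟩
      change polyDunkl Rp k i (W n _) = polyDunkl Rp k j (W n _)
      rw [(ih _ (hd j)).2, (ih _ (hd i)).2, pderiv_pderiv_comm]
  let V : Poly N →ₗ[ℂ] Poly N :=
    (basisMonomials (Fin N) ℂ).constr ℂ fun ν => W ν.degree (monomial ν 1)
  have hVm : ∀ ν (c : ℂ), V (monomial ν c) = W ν.degree (monomial ν c) := by
    intro ν c
    have h1 : (monomial ν c : Poly N) = c • basisMonomials (Fin N) ℂ ν := by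
      simp [smul_monomial]
    rw [h1, map_smul, map_smul, Module.Basis.constr_basis]
    simp
  have hV : ∀ n, ∀ p : Poly N, p.IsHomogeneous n → V p = W n p := by
    intro n p hp
    conv_lhs => rw [← support_sum_monomial_coeff p]
    conv_rhs => rw [← support_sum_monomial_coeff p]
    rw [map_sum, map_sum]
    refine Finset.sum_congr rfl fun ν hν => ?_
    have : ν.degree = n := by
      by_contra h
      exact mem_support_iff.mp hν (hp.coeff_eq_zero h)
    rw [hVm, this]
  refine ⟨V, fun n p hp => ?_, fun c => ?_, fun i p => ?_⟩
  · rw [hV n p hp]; exact (key n p hp).1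
  · rw [hV 0 _ (isHomogeneous_C _ c)]; rfl
  · conv_lhs => rw [← sum_homogeneousComponent p]
    conv_rhs => rw [← sum_homogeneousComponent p]
    simp only [map_sum]
    refine Finset.sum_congr rfl fun n _ => ?_
    have hn := homogeneousComponent_isHomogeneous n p
    rw [hV n _ hn, (key n _ hn).2, hV (n - 1) _ hn.pderiv]

lemma eq_zero_of_polyDunkl_eq_zero (hRp : ∀ α ∈ Rp, ‖α‖ ^ 2 = 2) (hk : ∀ α ∈ Rp, 0 ≤ k α)
    {n : ℕ} (hn : n ≠ 0) {p : Poly N} (hp : p.IsHomogeneous n)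
    (h : ∀ i, polyDunkl Rp k i p = 0) : p = 0 := by
  refine eulerOp_injective hRp hk hn ?_
  rw [← sum_X_mul_polyDunkl hp]
  exact Finset.sum_eq_zero fun i _ => by rw [h i, mul_zero]

/-- If V and V' agree in degree n, their difference in degree n + 1 is killed by every T_i, hence by
the Euler operator, which is injective there. -/
lemma PolyIntertwining.unique (hRp : ∀ α ∈ Rp, ‖α‖ ^ 2 = 2) (hk : ∀ α ∈ Rp, 0 ≤ k α)
    {V V' : Poly N →ₗ[ℂ] Poly N} (hV : PolyIntertwining Rp k V) (hV' : PolyIntertwining Rp k V') :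
    V = V' := by
  have key : ∀ n, ∀ p : Poly N, p.IsHomogeneous n → V p = V' p := by
    intro n
    induction n with
    | zero =>
      intro p hp
      rw [eq_C_of_isHomogeneous_zero hp, hV.map_C, hV'.map_C]
    | succ n ih =>
      intro p hp
      rw [← sub_eq_zero]
      refine eq_zero_of_polyDunkl_eq_zero hRp hk n.succ_ne_zero
        ((hV.isHomogeneous _ p hp).sub (hV'.isHomogeneous _ p hp)) fun i => ?_
      rw [map_sub, hV.intertwines, hV'.intertwines, ih _ hp.pderiv, sub_self]
  refine LinearMap.ext fun p => ?_
  rw [← sum_homogeneousComponent p, map_sum, map_sum]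
  exact Finset.sum_congr rfl fun n _ => key n _ (homogeneousComponent_isHomogeneous n p)

lemma eq_zero_of_pderiv_eq_zero {n : ℕ} (hn : n ≠ 0) {p : Poly N} (hp : p.IsHomogeneous n)
    (h : ∀ i, pderiv i p = 0) : p = 0 := by
  have := hp.sum_X_mul_pderiv
  simp only [h, mul_zero, Finset.sum_const_zero] at this
  exact (smul_eq_zero.mp this.symm).resolve_left hn

/-- If Vp = 0 then V∂_i p = T_i Vp = 0, so all ∂_i p vanish by induction, and p = 0 by Euler's
identity. Surjectivity in each degree follows by dimension. -/
lemma PolyIntertwining.injective {V : Poly N →ₗ[ℂ] Poly N} (hV : PolyIntertwining Rp k V) :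
    ∀ n, ∀ p : Poly N, p.IsHomogeneous n → V p = 0 → p = 0 := by
  intro n
  induction n with
  | zero =>
    intro p hp h
    rw [eq_C_of_isHomogeneous_zero hp, hV.map_C] at h
    rw [eq_C_of_isHomogeneous_zero hp, h]
  | succ n ih =>
    intro p hp h
    refine eq_zero_of_pderiv_eq_zero n.succ_ne_zero hp fun i => ih _ hp.pderiv ?_
    rw [← hV.intertwines, h, map_zero]

lemma PolyIntertwining.map_homogeneousSubmodule {V : Poly N →ₗ[ℂ] Poly N}
    (hV : PolyIntertwining Rp k V) (n : ℕ) :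
    (homogeneousSubmodule (Fin N) ℂ n).map V = homogeneousSubmodule (Fin N) ℂ n :=
  map_homogeneousSubmodule_eq (hV.isHomogeneous n) (hV.injective n)

lemma PolyIntertwining.surjective {V : Poly N →ₗ[ℂ] Poly N} (hV : PolyIntertwining Rp k V) :
    Function.Surjective V := by
  intro q
  choose f hf using fun n => (hV.map_homogeneousSubmodule n).ge
    (homogeneousComponent_isHomogeneous n q)
  refine ⟨∑ n ∈ Finset.range (q.totalDegree + 1), f n, ?_⟩
  rw [map_sum]
  conv_rhs => rw [← sum_homogeneousComponent q]
  exact Finset.sum_congr rfl fun n _ => (hf n).2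

lemma PolyIntertwining.polyDunkl_comm {V : Poly N →ₗ[ℂ] Poly N} (hV : PolyIntertwining Rp k V)
    (i j : Fin N) (p : Poly N) :
    polyDunkl Rp k i (polyDunkl Rp k j p) = polyDunkl Rp k j (polyDunkl Rp k i p) := by
  obtain ⟨q, rfl⟩ := hV.surjective p
  rw [hV.intertwines, hV.intertwines, hV.intertwines, hV.intertwines, pderiv_pderiv_comm]

end

end Dunkl

namespace Dunkl

section
open MvPolynomial
variable {N : ℕ} {Rp : Finset (Space N)} {k : Space N → ℝ}

/-! ### The Dunkl operators on polynomial functions -/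

/-- The inclusion of `ℝ^N` into its complexification. -/
noncomputable def toCSpace (x : Space N) : CSpace N := WithLp.toLp 2 fun i => (x i : ℂ)

lemma norm_toCSpace (x : Space N) : ‖toCSpace x‖ = ‖x‖ := by
  simp [EuclideanSpace.norm_eq, toCSpace]

lemma polyFun_eq_cEval (p : Poly N) (x : Space N) : polyFun p x = cEval (toCSpace x) p := by
  simp [polyFun, cEval, toCSpace]

lemma polyFun_injective : Function.Injective (polyFun : Poly N → Space N → ℂ) := by
  intro p q h
  refine MvPolynomial.funext_set (fun _ => Set.range ((↑) : ℝ → ℂ))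
    (fun _ => Set.infinite_range_of_injective Complex.ofReal_injective) fun x hx => ?_
  choose y hy using fun i => hx i (Set.mem_univ i)
  have := congrFun h (WithLp.toLp 2 y)
  simpa [polyFun, hy] using this

lemma toCSpace_rootRefl {a : Space N} (ha : ‖a‖ ^ 2 = 2) (x : Space N) :
    toCSpace (rootRefl a x) = cRefl a (toCSpace x) := by
  ext i
  rw [rootRefl_apply ha]
  simp [toCSpace, cRefl, PiLp.inner_apply, mul_comm]

lemma polyFun_polyRefl {a : Space N} (ha : ‖a‖ ^ 2 = 2) (p : Poly N) (x : Space N) :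
    polyFun (polyRefl a p) x = polyFun p (rootRefl a x) := by
  rw [polyFun_eq_cEval, cEval_polyRefl, ← toCSpace_rootRefl ha, polyFun_eq_cEval]

lemma polyFun_linForm (a x : Space N) : polyFun (linForm a) x = ((inner ℝ a x : ℝ) : ℂ) := by
  rw [polyFun_eq_cEval, cEval_linForm]
  simp [toCSpace, PiLp.inner_apply, mul_comm]

lemma hasFDerivAt_aeval {𝕜 F : Type*} [NontriviallyNormedField 𝕜] [NormedAlgebra 𝕜 ℂ]
    [NormedAddCommGroup F] [NormedSpace 𝕜 F] {g : Fin N → F → ℂ} {g' : Fin N → F →L[𝕜] ℂ} {x : F}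
    (hg : ∀ i, HasFDerivAt (g i) (g' i) x) (p : Poly N) :
    HasFDerivAt (fun y => aeval (fun i => g i y) p)
      (∑ i, aeval (fun i => g i x) (pderiv i p) • g' i) x := by
  induction p using MvPolynomial.induction_on with
  | C c =>
    simp only [algHom_C]
    exact (hasFDerivAt_const (𝕜 := 𝕜) _ x).congr_fderiv (ContinuousLinearMap.ext fun v => by simp)
  | add p q hp hq =>
    simp only [map_add]
    refine (hp.fun_add hq).congr_fderiv (ContinuousLinearMap.ext fun v => ?_)
    simp [add_mul, Finset.sum_add_distrib]
  | mul_X p l hp =>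
    simp only [map_mul, aeval_X]
    refine (hp.fun_mul (hg l)).congr_fderiv (ContinuousLinearMap.ext fun v => ?_)
    simp only [pderiv_mul, map_add, map_mul, aeval_X, _root_.add_apply,
      _root_.sum_apply, _root_.smul_apply, smul_eq_mul, add_mul,
      Finset.sum_add_distrib]
    rw [add_comm, Finset.mul_sum]
    congr 1
    · exact Finset.sum_congr rfl fun i _ => by ring
    · rw [Finset.sum_eq_single l]
      · simp
      · intro i _ hi
        simp [pderiv_X_of_ne (Ne.symm hi)]
      · simp

/-- The coordinate functions as complex-valued real-linear maps. -/
noncomputable def coordCLM (i : Fin N) : Space N →L[ℝ] ℂ :=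
  Complex.ofRealCLM ∘L (EuclideanSpace.proj i : Space N →L[ℝ] ℝ)

lemma coordCLM_apply (i : Fin N) (x : Space N) : coordCLM i x = (x i : ℂ) := rfl

/-- The Fréchet derivative of a polynomial function. -/
noncomputable def polyFDeriv (p : Poly N) (x : Space N) : Space N →L[ℝ] ℂ :=
  ∑ i, polyFun (pderiv i p) x • coordCLM i

lemma hasFDerivAt_polyFun (p : Poly N) (x : Space N) :
    HasFDerivAt (polyFun p) (polyFDeriv p x) x := by
  simpa [polyFDeriv, polyFun, coe_aeval_eq_eval, coordCLM_apply] using!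
    hasFDerivAt_aeval (𝕜 := ℝ) (fun i => (coordCLM i).hasFDerivAt (x := x)) p

lemma polyFDeriv_apply (p : Poly N) (x v : Space N) :
    polyFDeriv p x v = ∑ i, polyFun (pderiv i p) x * (v i : ℂ) := by
  simp [polyFDeriv, coordCLM_apply]

lemma polyFDeriv_single (p : Poly N) (x : Space N) (i : Fin N) :
    polyFDeriv p x (EuclideanSpace.single i 1) = polyFun (pderiv i p) x := by
  rw [polyFDeriv_apply, Finset.sum_eq_single i] <;> simp +contextual

lemma partialD_polyFun (i : Fin N) (p : Poly N) :
    partialD i (polyFun p) = polyFun (pderiv i p) := by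
  ext x
  rw [partialD, (hasFDerivAt_polyFun p x).fderiv, polyFDeriv_single]

lemma reflQuot_of_inner_eq_zero {a : Space N} (ha : ‖a‖ ^ 2 = 2) (f : Space N → ℂ) {x : Space N}
    (hx : inner ℝ a x = (0 : ℝ)) : reflQuot a f x = fderiv ℝ f x a := by
  rw [reflQuot, if_pos hx, ha, div_self (two_ne_zero' ℝ), one_smul]

lemma reflQuot_of_inner_ne_zero (a : Space N) (f : Space N → ℂ) {x : Space N}
    (hx : inner ℝ a x ≠ (0 : ℝ)) :
    reflQuot a f x = (f x - f (rootRefl a x)) / ((inner ℝ a x : ℝ) : ℂ) := by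
  rw [reflQuot, if_neg hx]

lemma reflQuot_polyFun {a : Space N} (ha : ‖a‖ ^ 2 = 2) (p : Poly N) :
    reflQuot a (polyFun p) = polyFun (polyQuot a p) := by
  ext x
  by_cases hx : inner ℝ a x = (0 : ℝ)
  · rw [reflQuot_of_inner_eq_zero ha _ hx, (hasFDerivAt_polyFun p x).fderiv, polyFDeriv_apply]
    set D : Poly N := ∑ i, C (a i : ℂ) * pderiv i p with hD
    have hDx : ∑ i, polyFun (pderiv i p) x * (a i : ℂ) = polyFun D x := by
      simp [hD, polyFun, mul_comm]
    have h2 : ∑ i, C (a i : ℂ) * C (a i : ℂ) = (2 : Poly N) := by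
      simp only [← C_mul, ← map_sum, sum_sq_of_norm_sq ha]; rfl
    -- Differentiate ⟨a, ·⟩q = p - σ_a p along a in two ways. On the hyperplane, where σ_a x = x and
    -- ⟨a, x⟩ = 0, this reads 2q(x) = 2D(x).
    have h1 : ∑ i, C (a i : ℂ) * pderiv i (linForm a * polyQuot a p) = D + polyRefl a D := by
      rw [linForm_mul_polyQuot]
      simp only [map_sub, pderiv_polyRefl, ← hD, mul_sub, Finset.sum_sub_distrib, ← mul_assoc,
        ← Finset.sum_mul, h2]
      have : ∑ i, C (a i : ℂ) * polyRefl a (pderiv i p) = polyRefl a D := by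
        rw [hD, map_sum]; simp
      rw [this]; ring
    have h3 : ∑ i, C (a i : ℂ) * pderiv i (linForm a * polyQuot a p) =
        2 * polyQuot a p + linForm a * ∑ i, C (a i : ℂ) * pderiv i (polyQuot a p) := by
      simp only [pderiv_mul, pderiv_linForm, mul_add, Finset.sum_add_distrib, ← mul_assoc,
        ← Finset.sum_mul, h2]
      congr 1
      rw [Finset.mul_sum]
      exact Finset.sum_congr rfl fun i _ => by ring
    have hσ : rootRefl a x = x := by rw [rootRefl_apply ha, hx]; simp
    have h4 : polyFun (D + polyRefl a D) x = polyFun (2 * polyQuot a p + linForm a *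
        ∑ i, C (a i : ℂ) * pderiv i (polyQuot a p)) x := by rw [← h1, h3]
    have h5 : polyFun D x + polyFun (polyRefl a D) x = 2 * polyFun (polyQuot a p) x +
        polyFun (linForm a) x * polyFun (∑ i, C (a i : ℂ) * pderiv i (polyQuot a p)) x := by
      simp only [polyFun, map_add, map_mul] at h4 ⊢
      simpa using h4
    rw [polyFun_polyRefl ha, hσ, polyFun_linForm, hx] at h5
    rw [hDx]
    simp only [Complex.ofReal_zero, zero_mul, add_zero] at h5
    linear_combination h5 / 2
  · rw [reflQuot_of_inner_ne_zero _ _ hx, div_eq_iff (by exact_mod_cast hx), mul_comm,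
      ← polyFun_linForm, ← polyFun_polyRefl ha]
    have := congrArg (fun q => polyFun q x) (linForm_mul_polyQuot a p)
    simpa [polyFun] using this.symm

lemma dunklOp_polyFun (hRp : ∀ α ∈ Rp, ‖α‖ ^ 2 = 2) (i : Fin N) (p : Poly N) :
    dunklOp Rp k i (polyFun p) = polyFun (polyDunkl Rp k i p) := by
  ext x
  rw [dunklOp, partialD_polyFun, polyDunkl_apply]
  have : ∀ α ∈ Rp, (k α : ℂ) * (α i : ℂ) * reflQuot α (polyFun p) x =
      polyFun (((k α : ℂ) * (α i : ℂ)) • polyQuot α p) x := by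
    intro α hα
    rw [reflQuot_polyFun (hRp α hα)]
    simp [polyFun]
  rw [Finset.sum_congr rfl this]
  simp [polyFun]

/-- The Dunkl Laplacian on polynomials. -/
noncomputable def polyLaplacian {N : ℕ} (Rp : Finset (Space N)) (k : Space N → ℝ) :
    Poly N →ₗ[ℂ] Poly N :=
  ∑ j, polyDunkl Rp k j ∘ₗ polyDunkl Rp k j

lemma polyLaplacian_apply (p : Poly N) :
    polyLaplacian Rp k p = ∑ j, polyDunkl Rp k j (polyDunkl Rp k j p) := by
  simp [polyLaplacian]

lemma dunklLaplacian_polyFun (hRp : ∀ α ∈ Rp, ‖α‖ ^ 2 = 2) (p : Poly N) :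
    dunklLaplacian Rp k (polyFun p) = polyFun (polyLaplacian Rp k p) := by
  ext x
  simp only [dunklLaplacian, dunklOp_polyFun hRp, polyLaplacian_apply]
  simp [polyFun]

lemma dunklLaplacian_iterate_polyFun (hRp : ∀ α ∈ Rp, ‖α‖ ^ 2 = 2) (n : ℕ) (p : Poly N) :
    (dunklLaplacian Rp k)^[n] (polyFun p) = polyFun ((polyLaplacian Rp k)^[n] p) := by
  induction n generalizing p with
  | zero => rfl
  | succ n ih => rw [Function.iterate_succ_apply, dunklLaplacian_polyFun hRp, ih,
      Function.iterate_succ_apply]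

lemma isHomogeneous_polyLaplacian (hRp : ∀ α ∈ Rp, ‖α‖ ^ 2 = 2) {n : ℕ} {p : Poly N}
    (hp : p.IsHomogeneous n) : (polyLaplacian Rp k p).IsHomogeneous (n - 2) := by
  rw [polyLaplacian_apply]
  exact IsHomogeneous.sum _ _ _ fun j _ =>
    isHomogeneous_polyDunkl hRp j (isHomogeneous_polyDunkl hRp j hp)

lemma isHomogeneous_polyLaplacian_iterate (hRp : ∀ α ∈ Rp, ‖α‖ ^ 2 = 2) (j : ℕ) {n : ℕ}
    {p : Poly N} (hp : p.IsHomogeneous n) :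
    ((polyLaplacian Rp k)^[j] p).IsHomogeneous (n - 2 * j) := by
  induction j with
  | zero => exact hp
  | succ j ih =>
    rw [Function.iterate_succ_apply', show n - 2 * (j + 1) = n - 2 * j - 2 by omega]
    exact isHomogeneous_polyLaplacian hRp ih

/-- Truncated subtraction in `isHomogeneous_polyLaplacian` hides this vanishing: one T_j already
leads to constants, which the second one kills. -/
lemma polyLaplacian_eq_zero (hRp : ∀ α ∈ Rp, ‖α‖ ^ 2 = 2) {n : ℕ} (hn : n < 2) {p : Poly N}
    (hp : p.IsHomogeneous n) : polyLaplacian Rp k p = 0 := by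
  rw [polyLaplacian_apply]
  refine Finset.sum_eq_zero fun j _ => ?_
  have h := isHomogeneous_polyDunkl (k := k) hRp j hp
  rw [show n - 1 = 0 by omega] at h
  rw [eq_C_of_isHomogeneous_zero h, polyDunkl_C hRp]

lemma polyLaplacian_iterate_eq_zero (hRp : ∀ α ∈ Rp, ‖α‖ ^ 2 = 2) {j n : ℕ} (hn : n < 2 * j)
    {p : Poly N} (hp : p.IsHomogeneous n) : (polyLaplacian Rp k)^[j] p = 0 := by
  obtain ⟨j, rfl⟩ : ∃ m, j = m + 1 := ⟨j - 1, by omega⟩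
  rw [Function.iterate_succ_apply']
  exact polyLaplacian_eq_zero hRp (by omega) (isHomogeneous_polyLaplacian_iterate hRp j hp)

lemma polyLaplacian_iterate_eq_pow (j : ℕ) (p : Poly N) :
    (polyLaplacian Rp k)^[j] p = (polyLaplacian Rp k ^ j) p :=
  (Module.End.pow_apply _ _ _).symm

lemma polyLaplacian_iterate_eq_zero_of_totalDegree_lt (hRp : ∀ α ∈ Rp, ‖α‖ ^ 2 = 2) {j : ℕ}
    {p : Poly N} (hp : p.totalDegree < 2 * j) : (polyLaplacian Rp k)^[j] p = 0 := by
  rw [polyLaplacian_iterate_eq_pow, ← sum_homogeneousComponent p, map_sum]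
  refine Finset.sum_eq_zero fun n hn => ?_
  rw [← polyLaplacian_iterate_eq_pow]
  rw [Finset.mem_range] at hn
  exact polyLaplacian_iterate_eq_zero hRp (by omega) (homogeneousComponent_isHomogeneous n p)

/-! ### Locally uniformly convergent series of polynomials -/

/-- A family of polynomials that is summable uniformly on every ball of `ℂ^N`. -/
def EntireFamily {ι : Type*} (p : ι → Poly N) : Prop :=
  ∀ r : ℝ, ∃ u : ι → ℝ, Summable u ∧ ∀ j (x : CSpace N), ‖x‖ ≤ r → ‖cEval x (p j)‖ ≤ u j

variable {ι : Type*} {p q : ι → Poly N}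

lemma EntireFamily.add (hp : EntireFamily p) (hq : EntireFamily q) :
    EntireFamily fun j => p j + q j := by
  intro r
  obtain ⟨u, hu, hpu⟩ := hp r
  obtain ⟨v, hv, hqv⟩ := hq r
  refine ⟨fun j => u j + v j, hu.add hv, fun j x hx => ?_⟩
  rw [map_add]
  exact (norm_add_le _ _).trans (add_le_add (hpu j x hx) (hqv j x hx))

lemma EntireFamily.const_smul (hp : EntireFamily p) (c : ℂ) :
    EntireFamily fun j => c • p j := by
  intro r
  obtain ⟨u, hu, hpu⟩ := hp r
  refine ⟨fun j => ‖c‖ * u j, hu.mul_left _, fun j x hx => ?_⟩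
  rw [map_smul, norm_smul]
  exact mul_le_mul_of_nonneg_left (hpu j x hx) (norm_nonneg c)

lemma entireFamily_zero : EntireFamily fun _ : ι => (0 : Poly N) :=
  fun _ => ⟨0, summable_zero, fun _ _ _ => by simp⟩

lemma EntireFamily.sum {κ : Type*} (s : Finset κ) {f : κ → ι → Poly N}
    (hf : ∀ a ∈ s, EntireFamily (f a)) : EntireFamily fun j => ∑ a ∈ s, f a j := by
  classical
  induction s using Finset.induction_on with
  | empty => simpa using entireFamily_zero
  | insert a s ha ih =>
    simp only [Finset.sum_insert ha]
    exact (hf a (Finset.mem_insert_self a s)).add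
      (ih fun b hb => hf b (Finset.mem_insert_of_mem hb))

lemma hasDerivAt_cEval (p : Poly N) (x v : CSpace N) (c : ℂ) :
    HasDerivAt (fun c : ℂ => cEval (x + c • v) p)
      (∑ i, cEval (x + c • v) (pderiv i p) * v i) c := by
  have h : ∀ i, HasFDerivAt (fun c : ℂ => (x + c • v) i)
      (ContinuousLinearMap.toSpanSingleton ℂ (v i)) c := by
    intro i
    have : HasDerivAt (fun c : ℂ => x i + c * v i) (v i) c := by
      simpa using ((hasDerivAt_id c).mul_const (v i)).const_add (x i)
    simpa using! this.hasFDerivAt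
  have := (hasFDerivAt_aeval h p).hasDerivAt
  refine this.congr_deriv ?_
  simp [cEval]

/-- Cauchy's estimate on a unit circle costs only a larger radius, not a larger bound. This is why
summability is required on complex balls. -/
lemma norm_cEval_pderiv_le {p : Poly N} (i : Fin N) {r u : ℝ}
    (h : ∀ x : CSpace N, ‖x‖ ≤ r + 1 → ‖cEval x p‖ ≤ u) {x : CSpace N} (hx : ‖x‖ ≤ r) :
    ‖cEval x (pderiv i p)‖ ≤ u := by
  set v : CSpace N := EuclideanSpace.single i 1 with hv
  have hd := hasDerivAt_cEval p x v 0
  have hderiv : deriv (fun c : ℂ => cEval (x + c • v) p) 0 = cEval x (pderiv i p) := by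
    rw [hd.deriv, zero_smul, add_zero, Finset.sum_eq_single i] <;> simp +contextual [hv]
  have := Complex.norm_deriv_le_of_forall_mem_sphere_norm_le (c := 0) (R := 1) (C := u)
    (f := fun c : ℂ => cEval (x + c • v) p) one_pos
    (Differentiable.diffContOnCl fun c => (hasDerivAt_cEval p x v c).differentiableAt) (by
      intro c hc
      refine h _ ((norm_add_le _ _).trans (add_le_add hx ?_))
      rw [norm_smul, hv, PiLp.norm_single]
      simpa using (mem_sphere_zero_iff_norm.mp hc).le)
  rwa [hderiv, div_one] at this

lemma EntireFamily.pderiv (hp : EntireFamily p) (i : Fin N) :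
    EntireFamily fun j => pderiv i (p j) := by
  intro r
  obtain ⟨u, hu, hpu⟩ := hp (r + 1)
  exact ⟨u, hu, fun j x hx => norm_cEval_pderiv_le i (hpu j) hx⟩

lemma norm_cEval_linForm_le {a : Space N} (ha : ‖a‖ ^ 2 = 2) (x : CSpace N) :
    ‖cEval x (linForm a)‖ ≤ 2 * ‖x‖ := by
  have h : cEval x (linForm a) = inner ℂ (toCSpace a) x := by
    rw [cEval_linForm, PiLp.inner_apply]
    simp [toCSpace, mul_comm]
  rw [h]
  refine (norm_inner_le_norm _ _).trans ?_
  rw [norm_toCSpace]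
  exact mul_le_mul_of_nonneg_right (by nlinarith [norm_nonneg a]) (norm_nonneg x)

/-- The denominator may vanish at x, so the quotient is bounded by the maximum modulus principle on
the complex line x + ca, using a circle on which the denominator is at least 2 in modulus. -/
lemma norm_cEval_polyQuot_le {a : Space N} (ha : ‖a‖ ^ 2 = 2) {p : Poly N} {r u : ℝ}
    (h : ∀ x : CSpace N, ‖x‖ ≤ 5 * r + 2 → ‖cEval x p‖ ≤ u) {x : CSpace N} (hx : ‖x‖ ≤ r) :
    ‖cEval x (polyQuot a p)‖ ≤ u := by
  set v : CSpace N := toCSpace a with hv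
  set s : ℂ := cEval x (linForm a) with hs
  have hvn : ‖v‖ ≤ 2 := by
    rw [hv, norm_toCSpace]; nlinarith [norm_nonneg a]
  have hsn : ‖s‖ ≤ 2 * r := (norm_cEval_linForm_le ha x).trans (by linarith)
  -- On the line the denominator is s + 2c, with zero -s/2. The disc of radius ρ about it contains c
  -- = 0. On its circle |s + 2c| = 2ρ ≥ 2 and |c| ≤ 2r + 1, and with |a| ≤ 2 this gives the radius r
  -- + 2(2r + 1) = 5r + 2.
  set ρ : ℝ := ‖s‖ / 2 + 1 with hρ
  have hρ1 : 1 ≤ ρ := by rw [hρ]; linarith [norm_nonneg s]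
  have hlin : ∀ c : ℂ, cEval (x + c • v) (linForm a) = s + 2 * c := by
    intro c
    rw [hs, cEval_linForm, cEval_linForm, ← sum_sq_of_norm_sq ha, Finset.sum_mul,
      ← Finset.sum_add_distrib]
    refine Finset.sum_congr rfl fun i _ => ?_
    simp [hv, toCSpace]; ring
  have hfront : ∀ c ∈ frontier (Metric.ball (-s / 2) ρ),
      ‖cEval (x + c • v) (polyQuot a p)‖ ≤ u := by
    intro c hc
    rw [frontier_ball _ (by linarith), mem_sphere_iff_norm] at hc
    have h1 : ‖s + 2 * c‖ = 2 * ρ := by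
      rw [← hc, show s + 2 * c = 2 * (c - -s / 2) by ring, norm_mul]; simp
    have hcn : ‖c‖ ≤ 2 * r + 1 := by
      calc ‖c‖ = ‖(c - -s / 2) + -s / 2‖ := by ring_nf
        _ ≤ ρ + ‖s‖ / 2 := by
          refine (norm_add_le _ _).trans (add_le_add hc.le ?_)
          simp
        _ ≤ 2 * r + 1 := by rw [hρ]; linarith
    have hy : ‖x + c • v‖ ≤ 5 * r + 2 := by
      refine (norm_add_le _ _).trans ?_
      rw [norm_smul]
      nlinarith [norm_nonneg c, norm_nonneg v, norm_nonneg x]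
    have h2 := congrArg (cEval (x + c • v)) (linForm_mul_polyQuot a p)
    rw [map_mul, hlin, map_sub, cEval_polyRefl] at h2
    have h3 : 2 * ρ * ‖cEval (x + c • v) (polyQuot a p)‖ ≤ u + u := by
      rw [← h1, ← norm_mul, h2]
      exact (norm_sub_le _ _).trans
        (add_le_add (h _ hy) (h _ (by rwa [norm_cRefl ha])))
    nlinarith [norm_nonneg (cEval (x + c • v) (polyQuot a p))]
  have := Complex.norm_le_of_forall_mem_frontier_norm_le
    (f := fun c : ℂ => cEval (x + c • v) (polyQuot a p)) (Metric.isBounded_ball)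
    (Differentiable.diffContOnCl fun c =>
      (hasDerivAt_cEval (polyQuot a p) x v c).differentiableAt) hfront (z := 0)
    (subset_closure (by
      rw [Metric.mem_ball, dist_eq_norm, hρ]
      simp))
  simpa using this

lemma EntireFamily.polyQuot {a : Space N} (ha : ‖a‖ ^ 2 = 2) (hp : EntireFamily p) :
    EntireFamily fun j => polyQuot a (p j) := by
  intro r
  obtain ⟨u, hu, hpu⟩ := hp (5 * r + 2)
  exact ⟨u, hu, fun j x hx => norm_cEval_polyQuot_le ha (hpu j) hx⟩

lemma EntireFamily.polyDunkl (hRp : ∀ α ∈ Rp, ‖α‖ ^ 2 = 2) (hp : EntireFamily p) (i : Fin N) :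
    EntireFamily fun j => polyDunkl Rp k i (p j) := by
  simp only [polyDunkl_apply]
  exact (hp.pderiv i).add (EntireFamily.sum _ fun α hα =>
    (hp.polyQuot (hRp α hα)).const_smul _)

lemma EntireFamily.summable (hp : EntireFamily p) (x : Space N) :
    Summable fun j => polyFun (p j) x := by
  obtain ⟨u, hu, hpu⟩ := hp ‖x‖
  exact Summable.of_norm_bounded hu fun j => by
    rw [polyFun_eq_cEval]; exact hpu j _ (norm_toCSpace x).le

lemma EntireFamily.exists_polyFDeriv_bound (hp : EntireFamily p) (r : ℝ) :
    ∃ u : ι → ℝ, Summable u ∧ ∀ j (x : Space N), ‖x‖ ≤ r → ‖polyFDeriv (p j) x‖ ≤ u j := by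
  choose u hu hpu using fun i => hp.pderiv i r
  refine ⟨fun j => ∑ i, u i j * ‖coordCLM i‖, summable_sum fun i _ => (hu i).mul_right _,
    fun j x hx => ?_⟩
  refine (norm_sum_le _ _).trans (Finset.sum_le_sum fun i _ => ?_)
  rw [norm_smul, polyFun_eq_cEval]
  exact mul_le_mul_of_nonneg_right (hpu i j _ ((norm_toCSpace x).trans_le hx)) (norm_nonneg _)

lemma EntireFamily.hasFDerivAt (hp : EntireFamily p) (x : Space N) :
    HasFDerivAt (fun y => ∑' j, polyFun (p j) y) (∑' j, polyFDeriv (p j) x) x := by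
  obtain ⟨u, hu, hpu⟩ := hp.exists_polyFDeriv_bound (‖x‖ + 1)
  have hx : x ∈ Metric.ball (0 : Space N) (‖x‖ + 1) := by simp
  exact hasFDerivAt_tsum_of_isPreconnected hu Metric.isOpen_ball
    (convex_ball (0 : Space N) (‖x‖ + 1)).isPreconnected
    (fun j y _ => hasFDerivAt_polyFun (p j) y)
    (fun j y hy => hpu j y (mem_ball_zero_iff.mp hy).le) hx (hp.summable x) hx

lemma EntireFamily.fderiv_apply (hp : EntireFamily p) (x v : Space N) :
    fderiv ℝ (fun y => ∑' j, polyFun (p j) y) x v = ∑' j, polyFDeriv (p j) x v := by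
  obtain ⟨u, hu, hpu⟩ := hp.exists_polyFDeriv_bound ‖x‖
  have hsum : Summable fun j => polyFDeriv (p j) x :=
    Summable.of_norm_bounded hu fun j => hpu j x le_rfl
  rw [(hp.hasFDerivAt x).fderiv]
  exact (ContinuousLinearMap.apply ℝ ℂ v).map_tsum hsum

lemma EntireFamily.reflQuot_tsum {a : Space N} (ha : ‖a‖ ^ 2 = 2) (hp : EntireFamily p)
    (x : Space N) : reflQuot a (fun y => ∑' j, polyFun (p j) y) x =
      ∑' j, polyFun (Dunkl.polyQuot a (p j)) x := by
  simp only [← reflQuot_polyFun ha]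
  by_cases hx : inner ℝ a x = (0 : ℝ)
  · simp only [reflQuot_of_inner_eq_zero ha _ hx, hp.fderiv_apply,
      (hasFDerivAt_polyFun _ x).fderiv]
  · simp only [reflQuot_of_inner_ne_zero _ _ hx]
    rw [tsum_div_const, Summable.tsum_sub (hp.summable _) (hp.summable _)]

lemma EntireFamily.dunklOp_tsum (hRp : ∀ α ∈ Rp, ‖α‖ ^ 2 = 2) (hp : EntireFamily p) (i : Fin N) :
    dunklOp Rp k i (fun y => ∑' j, polyFun (p j) y) =
      fun y => ∑' j, polyFun (Dunkl.polyDunkl Rp k i (p j)) y := by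
  ext x
  have h1 : ∀ j, polyFun (Dunkl.polyDunkl Rp k i (p j)) x = polyFun (MvPolynomial.pderiv i (p j)) x +
      ∑ α ∈ Rp, (k α : ℂ) * (α i : ℂ) * polyFun (Dunkl.polyQuot α (p j)) x := by
    intro j
    rw [polyDunkl_apply]
    simp [polyFun]
  have h2 : ∀ α ∈ Rp, Summable fun j =>
      (k α : ℂ) * (α i : ℂ) * polyFun (Dunkl.polyQuot α (p j)) x :=
    fun α hα => ((hp.polyQuot (hRp α hα)).summable x).mul_left _
  simp only [h1]
  rw [Summable.tsum_add ((hp.pderiv i).summable x) (summable_sum h2), Summable.tsum_finsetSum h2,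
    dunklOp, partialD, hp.fderiv_apply]
  simp only [polyFDeriv_single]
  congr 1
  refine Finset.sum_congr rfl fun α hα => ?_
  rw [hp.reflQuot_tsum (hRp α hα), tsum_mul_left]

end

end Dunkl

namespace Dunkl

section
open MvPolynomial
variable {N : ℕ} {Rp : Finset (Space N)} {k : Space N → ℝ}

/-! ### The pairing `[p, q] = (p(T) q)(0)` -/

/-- The monomial `T^ν` in the Dunkl operators, acting on polynomials. -/
noncomputable def dunklPow {N : ℕ} (Rp : Finset (Space N)) (k : Space N → ℝ) (ν : Fin N →₀ ℕ) :
    Module.End ℂ (Poly N) :=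
  ((List.finRange N).map fun i => polyDunkl Rp k i ^ ν i).prod

/-- The bilinear pairing `[p, q] = (p(T) q)(0)`. -/
noncomputable def dunklPair {N : ℕ} (Rp : Finset (Space N)) (k : Space N → ℝ) :
    Poly N →ₗ[ℂ] Poly N →ₗ[ℂ] ℂ :=
  (basisMonomials (Fin N) ℂ).constr ℂ fun ν => (cEval 0).toLinearMap ∘ₗ dunklPow Rp k ν

/-- Commutativity of the Dunkl operators on polynomials. -/
def DunklCommute {N : ℕ} (Rp : Finset (Space N)) (k : Space N → ℝ) : Prop :=
  ∀ i j : Fin N, Commute (polyDunkl Rp k i) (polyDunkl Rp k j)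

lemma PolyIntertwining.dunklCommute {V : Poly N →ₗ[ℂ] Poly N} (hV : PolyIntertwining Rp k V) :
    DunklCommute Rp k :=
  fun i j => LinearMap.ext fun p => hV.polyDunkl_comm i j p

lemma dunklPair_monomial (ν : Fin N →₀ ℕ) (q : Poly N) :
    dunklPair Rp k (monomial ν 1) q = cEval 0 (dunklPow Rp k ν q) := by
  have h := (basisMonomials (Fin N) ℂ).constr_basis ℂ
    (fun ν => (cEval 0).toLinearMap ∘ₗ dunklPow Rp k ν) ν
  rw [coe_basisMonomials] at h
  exact LinearMap.congr_fun h q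

lemma dunklPair_C (c : ℂ) (q : Poly N) : dunklPair Rp k (C c) q = c * cEval 0 q := by
  have h : (C c : Poly N) = c • monomial 0 1 := by rw [smul_monomial]; simp
  rw [h, map_smul, LinearMap.smul_apply, dunklPair_monomial]
  simp [dunklPow]

lemma DunklCommute.pow_add_single (hc : DunklCommute Rp k) (ν : Fin N →₀ ℕ) (i : Fin N) :
    dunklPow Rp k (ν + Finsupp.single i 1) = dunklPow Rp k ν * polyDunkl Rp k i := by
  classical
  have hprod : ∀ l : List (Fin N),
      Commute (polyDunkl Rp k i) (l.map fun a => polyDunkl Rp k a ^ ν a).prod := fun l =>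
    Commute.list_prod_right _ _ fun x hx => by
      obtain ⟨a, -, rfl⟩ := List.mem_map.mp hx
      exact (hc i a).pow_right _
  have key : ∀ l : List (Fin N), l.Nodup →
      (l.map fun a => polyDunkl Rp k a ^ (ν + Finsupp.single i 1 : Fin N →₀ ℕ) a).prod =
      (l.map fun a => polyDunkl Rp k a ^ ν a).prod *
        (if i ∈ l then polyDunkl Rp k i else 1) := by
    intro l
    induction l with
    | nil => simp
    | cons a l ih =>
      intro hl
      rw [List.nodup_cons] at hl
      rw [List.map_cons, List.prod_cons, ih hl.2, List.map_cons, List.prod_cons]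
      by_cases hia : i = a
      · subst hia
        have h1 : (ν + Finsupp.single i 1 : Fin N →₀ ℕ) i = ν i + 1 := by simp
        rw [h1, pow_succ, if_neg hl.1, if_pos List.mem_cons_self, mul_one, mul_assoc, mul_assoc,
          (hprod l).eq]
      · have h1 : (ν + Finsupp.single i 1 : Fin N →₀ ℕ) a = ν a := by
          simp [Ne.symm hia]
        rw [h1, mul_assoc]
        simp [List.mem_cons, hia]
  have := key _ (List.nodup_finRange N)
  rwa [if_pos (List.mem_finRange i)] at this

lemma linearMap_ext_monomial {M : Type*} [AddCommGroup M] [Module ℂ M] {f g : Poly N →ₗ[ℂ] M}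
    (h : ∀ ν, f (monomial ν 1) = g (monomial ν 1)) : f = g :=
  (basisMonomials (Fin N) ℂ).ext fun ν => by simpa using h ν

lemma dunklPair_X_mul (hc : DunklCommute Rp k) (i : Fin N) (p q : Poly N) :
    dunklPair Rp k (X i * p) q = dunklPair Rp k p (polyDunkl Rp k i q) := by
  have h : (dunklPair Rp k).flip q ∘ₗ LinearMap.mulLeft ℂ (X i) =
      (dunklPair Rp k).flip (polyDunkl Rp k i q) := by
    refine linearMap_ext_monomial fun ν => ?_
    have hX : (X i * monomial ν 1 : Poly N) = monomial (ν + Finsupp.single i 1) 1 := by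
      rw [X, monomial_mul, add_comm, one_mul]
    simp only [LinearMap.comp_apply, LinearMap.flip_apply, LinearMap.mulLeft_apply, hX,
      dunklPair_monomial, hc.pow_add_single, Module.End.mul_apply]
  exact LinearMap.congr_fun h p

lemma dunklPair_linForm_mul (hc : DunklCommute Rp k) (b : Space N) (p q : Poly N) :
    dunklPair Rp k (linForm b * p) q =
      dunklPair Rp k p (∑ i, (b i : ℂ) • polyDunkl Rp k i q) := by
  simp only [linForm, Finset.sum_mul, map_sum, LinearMap.sum_apply, ← smul_eq_C_mul,
    smul_mul_assoc, map_smul, LinearMap.smul_apply, dunklPair_X_mul hc]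

/-- Invariance holds because the T_i transform under σ_b as the variables x_i do. -/
lemma dunklPair_polyRefl (hRp : ∀ α ∈ Rp, ‖α‖ ^ 2 = 2) (hc : DunklCommute Rp k)
    (he : DunklEquivariant Rp k) {b : Space N} (hb : b ∈ Rp) (p q : Poly N) :
    dunklPair Rp k (polyRefl b p) (polyRefl b q) = dunklPair Rp k p q := by
  induction p using MvPolynomial.induction_on generalizing q with
  | C c =>
    rw [polyRefl_C, dunklPair_C, dunklPair_C, cEval_polyRefl]
    have : cRefl b 0 = 0 := by ext i; simp [cRefl]
    rw [this]
  | add p r hp hr => simp only [map_add, LinearMap.add_apply, hp, hr]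
  | mul_X p i hp =>
    rw [mul_comm p, dunklPair_X_mul hc, ← hp, map_mul, polyRefl_X, sub_mul, mul_assoc,
      map_sub, LinearMap.sub_apply, ← smul_eq_C_mul, map_smul, LinearMap.smul_apply,
      dunklPair_X_mul hc, dunklPair_linForm_mul hc, ← map_smul, ← map_sub]
    congr 1
    set D := ∑ l, (b l : ℂ) • polyDunkl Rp k l q with hD
    have h1 : ∑ l, (b l : ℂ) • polyDunkl Rp k l (polyRefl b q) = -polyRefl b D := by
      simp only [he b hb, ← hD, map_sub, map_smul, smul_sub, Finset.sum_sub_distrib, smul_smul,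
        ← Finset.sum_smul]
      rw [sum_sq_of_norm_sq (hRp b hb)]
      have : ∑ l, (b l : ℂ) • polyRefl b (polyDunkl Rp k l q) = polyRefl b D := by
        rw [hD, map_sum]; simp only [map_smul]
      rw [this]; module
    rw [h1, he b hb, ← hD, map_sub, map_smul]
    module

/-- The commutator of T_i and x_j is symmetric in i and j, and its reflection terms can be moved
across the pairing by invariance. Induction on p then compares T_j(x_i q) with T_i(x_j p). -/
lemma dunklPair_X_mul_right (hRp : ∀ α ∈ Rp, ‖α‖ ^ 2 = 2) (hc : DunklCommute Rp k)
    (he : DunklEquivariant Rp k) (i : Fin N) (p q : Poly N) :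
    dunklPair Rp k p (X i * q) = dunklPair Rp k (polyDunkl Rp k i p) q := by
  induction p using MvPolynomial.induction_on generalizing q with
  | C c => simp [dunklPair_C, polyDunkl_C hRp, cEval_X]
  | add p r hp hr => simp only [map_add, LinearMap.add_apply, hp, hr]
  | mul_X p j hp =>
    rw [mul_comm p, dunklPair_X_mul hc, polyDunkl_X_mul hRp, polyDunkl_X_mul hRp]
    simp only [map_add, map_sum, map_smul, LinearMap.add_apply, LinearMap.sum_apply,
      LinearMap.smul_apply, dunklPair_X_mul hc, hp]
    congr 1
    · congr 1
      by_cases hij : i = j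
      · rw [if_pos hij, if_pos hij.symm]
      · rw [if_neg hij, if_neg (Ne.symm hij)]; simp
    · refine Finset.sum_congr rfl fun α hα => ?_
      rw [← dunklPair_polyRefl hRp hc he hα (polyRefl α p) q, polyRefl_polyRefl (hRp α hα)]
      congr 1; ring

/-- The polynomial `|x|²`. -/
noncomputable def normSqPoly (N : ℕ) : Poly N := ∑ i, X i * X i

lemma dunklPair_normSqPoly_pow_mul (hRp : ∀ α ∈ Rp, ‖α‖ ^ 2 = 2) (hc : DunklCommute Rp k)
    (he : DunklEquivariant Rp k) (j : ℕ) (p q : Poly N) :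
    dunklPair Rp k p (normSqPoly N ^ j * q) = dunklPair Rp k ((polyLaplacian Rp k)^[j] p) q := by
  induction j generalizing p with
  | zero => simp
  | succ j ih =>
    have h1 : ∀ r, dunklPair Rp k p (normSqPoly N * r) =
        dunklPair Rp k (polyLaplacian Rp k p) r := by
      intro r
      simp only [normSqPoly, Finset.sum_mul, map_sum, mul_assoc, dunklPair_X_mul_right hRp hc he,
        polyLaplacian_apply, LinearMap.sum_apply]
    rw [pow_succ', mul_assoc, h1, ih, Function.iterate_succ_apply]

/-! ### The homogeneous parts of the Dunkl kernel -/

/-- The linear form `⟨·, z⟩` with complex coefficients. -/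
noncomputable def cLinForm (z : Fin N → ℂ) : Poly N := ∑ i, C (z i) * X i

/-- The degree `n` part of the Dunkl kernel built from `V`, as a polynomial in `x`. -/
noncomputable def kernelPoly (V : Poly N →ₗ[ℂ] Poly N) (z : Fin N → ℂ) (n : ℕ) : Poly N :=
  V (((n.factorial : ℂ)⁻¹) • cLinForm z ^ n)

lemma pderiv_cLinForm (z : Fin N → ℂ) (i : Fin N) : pderiv i (cLinForm z) = C (z i) := by
  classical
  simp [cLinForm, pderiv_X, Pi.single_apply]

lemma isHomogeneous_cLinForm (z : Fin N → ℂ) : (cLinForm z).IsHomogeneous 1 :=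
  IsHomogeneous.sum _ _ _ fun i _ => isHomogeneous_C_mul_X _ i

variable {V : Poly N →ₗ[ℂ] Poly N}

lemma PolyIntertwining.isHomogeneous_kernelPoly (hV : PolyIntertwining Rp k V) (z : Fin N → ℂ)
    (n : ℕ) : (kernelPoly V z n).IsHomogeneous n := by
  refine hV.isHomogeneous n _ (isHomogeneous_smul ?_ _)
  simpa using (isHomogeneous_cLinForm z).pow n

lemma PolyIntertwining.kernelPoly_zero (hV : PolyIntertwining Rp k V) (z : Fin N → ℂ) :
    kernelPoly V z 0 = 1 := by
  have := hV.map_C 1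
  simpa [kernelPoly] using this

lemma PolyIntertwining.polyDunkl_kernelPoly_succ (hV : PolyIntertwining Rp k V) (z : Fin N → ℂ)
    (i : Fin N) (n : ℕ) :
    polyDunkl Rp k i (kernelPoly V z (n + 1)) = z i • kernelPoly V z n := by
  rw [kernelPoly, kernelPoly, hV.intertwines, ← map_smul]
  congr 1
  have h : pderiv i (cLinForm z ^ (n + 1)) = (((n : ℂ) + 1) * z i) • cLinForm z ^ n := by
    rw [pderiv_pow, pderiv_cLinForm, Nat.add_sub_cancel, smul_eq_C_mul]
    simp
    ring
  rw [Derivation.map_smul, h, smul_smul, smul_smul, Nat.factorial_succ]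
  congr 1
  have h1 : ((n : ℂ) + 1) ≠ 0 := by exact_mod_cast n.succ_ne_zero
  have h2 : (n.factorial : ℂ) ≠ 0 := by exact_mod_cast n.factorial_ne_zero
  push_cast
  field_simp

lemma norm_sum_mul_le (z x : CSpace N) : ‖∑ i, z i * x i‖ ≤ ‖z‖ * ‖x‖ := by
  have h : ∑ i, z i * x i =
      inner ℂ (WithLp.toLp 2 (fun i => (starRingEnd ℂ) (z i)) : CSpace N) x := by
    rw [PiLp.inner_apply]
    simp [mul_comm]
  rw [h]
  refine (norm_inner_le_norm _ _).trans_eq ?_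
  congr 1
  simp [EuclideanSpace.norm_eq]

lemma cEval_cLinForm (z : Fin N → ℂ) (x : CSpace N) :
    cEval x (cLinForm z) = ∑ i, z i * x i := by
  simp [cLinForm, cEval_X]

lemma PolyIntertwining.norm_cEval_kernelPoly_le (hRp : ∀ α ∈ Rp, ‖α‖ ^ 2 = 2)
    (hk : ∀ α ∈ Rp, 0 ≤ k α) (hV : PolyIntertwining Rp k V) (z : CSpace N) (n : ℕ) {r : ℝ}
    {x : CSpace N} (hx : ‖x‖ ≤ r) :
    ‖cEval x (kernelPoly V z n)‖ ≤ (r * ‖z‖) ^ n / n.factorial := by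
  induction n generalizing x with
  | zero => simp [hV.kernelPoly_zero]
  | succ n ih =>
    have hr : 0 ≤ r := (norm_nonneg x).trans hx
    have h1 : eulerOp Rp k (n + 1) (kernelPoly V z (n + 1)) = cLinForm z * kernelPoly V z n := by
      rw [← sum_X_mul_polyDunkl (hV.isHomogeneous_kernelPoly z (n + 1)), cLinForm, Finset.sum_mul]
      refine Finset.sum_congr rfl fun i _ => ?_
      rw [hV.polyDunkl_kernelPoly_succ, smul_eq_C_mul]; ring
    -- The Euler operator sends K_{n+1} to ⟨·, z⟩K_n and is bounded below by n + 1, which yields the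
    -- factorial.
    have h2 := mul_norm_cEval_le hRp hk (n + 1) (p := kernelPoly V z (n + 1)) (r := r)
      (G := r * ‖z‖ * ((r * ‖z‖) ^ n / n.factorial)) (fun y hy => by
        rw [h1, map_mul, norm_mul, cEval_cLinForm]
        refine mul_le_mul ?_ (ih hy) (norm_nonneg _) (by positivity)
        refine (norm_sum_mul_le z y).trans ?_
        rw [mul_comm]
        exact mul_le_mul_of_nonneg_right hy (norm_nonneg z)) x hx
    have hn : (0 : ℝ) < ((n + 1 : ℕ) : ℝ) := by positivity
    have hf : (0 : ℝ) < n.factorial := by positivity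
    rw [Nat.factorial_succ, Nat.cast_mul, le_div_iff₀ (by positivity)]
    calc ‖cEval x (kernelPoly V z (n + 1))‖ * (((n + 1 : ℕ) : ℝ) * n.factorial)
        = ((n + 1 : ℕ) : ℝ) * ‖cEval x (kernelPoly V z (n + 1))‖ * n.factorial := by ring
      _ ≤ r * ‖z‖ * ((r * ‖z‖) ^ n / n.factorial) * n.factorial :=
          mul_le_mul_of_nonneg_right h2 hf.le
      _ = (r * ‖z‖) ^ (n + 1) := by field_simp; ring

lemma homogeneousComponent_succ_X_mul (i : Fin N) (p : Poly N) (l : ℕ) :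
    homogeneousComponent (l + 1) (X i * p) = X i * homogeneousComponent l p := by
  rw [add_comm]
  exact homogeneousComponent_mul (isHomogeneous_X ℂ i) p l

lemma homogeneousComponent_C (c : ℂ) (l : ℕ) :
    homogeneousComponent l (C c : Poly N) = if l = 0 then C c else 0 :=
  homogeneousComponent_of_mem (isHomogeneous_C _ c)

/-- The degree `l` part of the kernel reproduces the degree `l` part of a polynomial. -/
lemma PolyIntertwining.dunklPair_kernelPoly (hRp : ∀ α ∈ Rp, ‖α‖ ^ 2 = 2)
    (hV : PolyIntertwining Rp k V) (z : CSpace N) (p : Poly N) (l : ℕ) :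
    dunklPair Rp k p (kernelPoly V z l) = cEval z (homogeneousComponent l p) := by
  have hc := hV.dunklCommute
  induction p using MvPolynomial.induction_on generalizing l with
  | C c =>
    rw [dunklPair_C, homogeneousComponent_C]
    cases l with
    | zero => simp [hV.kernelPoly_zero]
    | succ l =>
      rw [if_neg l.succ_ne_zero, map_zero]
      have := hV.isHomogeneous_kernelPoly z (l + 1)
      have h0 : cEval (0 : CSpace N) (kernelPoly V z (l + 1)) =
          coeff 0 (kernelPoly V z (l + 1)) := by
        simp only [cEval, PiLp.zero_apply]
        exact congrFun (congrArg DFunLike.coe (MvPolynomial.eval_zero' (σ := Fin N) (R := ℂ))) _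
      rw [h0, this.coeff_eq_zero (by simp), mul_zero]
  | add p r hp hr => simp only [map_add, LinearMap.add_apply, hp, hr]
  | mul_X p i hp =>
    rw [mul_comm p, dunklPair_X_mul hc]
    cases l with
    | zero =>
      rw [hV.kernelPoly_zero, ← C_1, polyDunkl_C hRp, map_zero, homogeneousComponent_zero,
        mul_comm (X i) p, coeff_mul_X']
      simp
    | succ l =>
      rw [hV.polyDunkl_kernelPoly_succ, map_smul, hp, homogeneousComponent_succ_X_mul, map_mul,
        cEval_X, smul_eq_mul]

/-! ### The kernel as a series in its second variable -/

/-- The polynomial `z ↦ Λ(⟨·, z⟩^n / n!)` for a linear functional `Λ`. -/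
noncomputable def functionalPoly {N : ℕ} : ℕ → (Poly N →ₗ[ℂ] ℂ) → Poly N
  | 0, Λ => C (Λ 1)
  | n + 1, Λ => ((n + 1 : ℂ)⁻¹) •
      ∑ i, X i * functionalPoly n (Λ ∘ₗ LinearMap.mulLeft ℂ (X i))

lemma cEval_functionalPoly (z : CSpace N) (n : ℕ) (Λ : Poly N →ₗ[ℂ] ℂ) :
    cEval z (functionalPoly n Λ) = Λ (((n.factorial : ℂ)⁻¹) • cLinForm z ^ n) := by
  induction n generalizing Λ with
  | zero => simp [functionalPoly]
  | succ n ih =>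
    rw [functionalPoly, map_smul, map_sum]
    simp only [map_mul, cEval_X, ih, LinearMap.comp_apply, LinearMap.mulLeft_apply]
    simp only [← smul_eq_mul, ← map_smul, ← map_sum]
    congr 1
    have h : cLinForm z ^ (n + 1) = ∑ i, z i • (X i * cLinForm z ^ n) := by
      rw [pow_succ']
      generalize cLinForm (z : Fin N → ℂ) ^ n = q
      rw [cLinForm, Finset.sum_mul]
      exact Finset.sum_congr rfl fun i _ => by rw [smul_eq_C_mul, mul_assoc]
    rw [h, Nat.factorial_succ, Finset.smul_sum, Finset.smul_sum]
    refine Finset.sum_congr rfl fun i _ => ?_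
    rw [smul_eq_mul, mul_smul_comm, smul_smul, smul_smul, smul_smul]
    congr 1
    push_cast
    rw [mul_inv]; ring

lemma pderiv_functionalPoly_succ (j : Fin N) (n : ℕ) (Λ : Poly N →ₗ[ℂ] ℂ) :
    pderiv j (functionalPoly (n + 1) Λ) =
      functionalPoly n (Λ ∘ₗ LinearMap.mulLeft ℂ (X j)) := by
  classical
  have hsum : ∀ n : ℕ, ∀ Λ : Poly N →ₗ[ℂ] ℂ,
      pderiv j (functionalPoly (n + 1) Λ) = ((n + 1 : ℂ)⁻¹) •
        (functionalPoly n (Λ ∘ₗ LinearMap.mulLeft ℂ (X j)) +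
        ∑ i, X i * pderiv j (functionalPoly n (Λ ∘ₗ LinearMap.mulLeft ℂ (X i)))) := by
    intro n Λ
    rw [functionalPoly, Derivation.map_smul, map_sum]
    simp only [pderiv_mul, Finset.sum_add_distrib]
    congr 2
    rw [Finset.sum_eq_single j]
    · simp
    · intro i _ hi; simp [pderiv_X_of_ne hi]
    · simp
  induction n generalizing Λ with
  | zero => rw [hsum]; simp [functionalPoly]
  | succ n ih =>
    rw [hsum]
    simp only [ih]
    have hcomm : ∀ i, (Λ ∘ₗ LinearMap.mulLeft ℂ (X i)) ∘ₗ LinearMap.mulLeft ℂ (X j) =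
        (Λ ∘ₗ LinearMap.mulLeft ℂ (X j)) ∘ₗ LinearMap.mulLeft ℂ (X i : Poly N) := by
      intro i
      refine LinearMap.ext fun p => ?_
      simp only [LinearMap.comp_apply, LinearMap.mulLeft_apply, mul_left_comm]
    simp only [hcomm]
    have h2 : ∑ i, X i * functionalPoly n
        ((Λ ∘ₗ LinearMap.mulLeft ℂ (X j)) ∘ₗ LinearMap.mulLeft ℂ (X i)) =
        (n + 1 : ℂ) • functionalPoly (n + 1) (Λ ∘ₗ LinearMap.mulLeft ℂ (X j)) := by
      rw [functionalPoly, smul_smul, mul_inv_cancel₀ (by exact_mod_cast n.succ_ne_zero), one_smul]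
    have h3 : ((n : ℂ) + 1 + 1) ≠ 0 := by exact_mod_cast (n + 1).succ_ne_zero
    rw [h2]
    push_cast
    generalize functionalPoly (n + 1) (Λ ∘ₗ LinearMap.mulLeft ℂ (X j)) = F
    rw [show F + ((n : ℂ) + 1) • F = ((n : ℂ) + 1 + 1) • F by module, smul_smul,
      inv_mul_cancel₀ h3, one_smul]

lemma polyDunkl_empty (i : Fin N) (p : Poly N) : polyDunkl ∅ k i p = pderiv i p := by
  simp [polyDunkl_apply]

lemma dunklCommute_empty : DunklCommute (∅ : Finset (Space N)) k := by
  intro i j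
  refine LinearMap.ext fun p => ?_
  simp only [Module.End.mul_apply, polyDunkl_empty]
  exact pderiv_pderiv_comm i j p

lemma dunklEquivariant_empty : DunklEquivariant (∅ : Finset (Space N)) k := by
  intro b hb
  simp at hb

/-- This is the reproducing property in the second variable of the kernel: ∂_i replaces Λ by Λ(x_i
·), so p(∂) at 0 feeds p into Λ. -/
lemma dunklPair_empty_functionalPoly (p : Poly N) (l : ℕ) (Λ : Poly N →ₗ[ℂ] ℂ) :
    dunklPair ∅ k p (functionalPoly l Λ) = Λ (homogeneousComponent l p) := by
  induction p using MvPolynomial.induction_on generalizing l Λ with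
  | C c =>
    rw [dunklPair_C, homogeneousComponent_C]
    cases l with
    | zero =>
      rw [functionalPoly, cEval_C, if_pos rfl, ← smul_eq_mul, ← map_smul, smul_eq_C_mul, mul_one]
    | succ l =>
      rw [if_neg l.succ_ne_zero, functionalPoly]
      simp [cEval_X]
  | add p r hp hr => simp only [map_add, LinearMap.add_apply, hp, hr]
  | mul_X p i hp =>
    rw [mul_comm p, dunklPair_X_mul dunklCommute_empty, polyDunkl_empty]
    cases l with
    | zero =>
      rw [functionalPoly, pderiv_C, map_zero, homogeneousComponent_zero, mul_comm (X i) p,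
        coeff_mul_X']
      simp
    | succ l =>
      rw [pderiv_functionalPoly_succ, hp, homogeneousComponent_succ_X_mul]
      simp

end

end Dunkl

/-! ### Gaussian times kernel, and the two Appell formulas. -/

namespace Dunkl

section
open MvPolynomial
variable {N : ℕ} {Rp : Finset (Space N)} {k : Space N → ℝ}

lemma isIntertwining_iff (hRp : ∀ α ∈ Rp, ‖α‖ ^ 2 = 2) {V : Poly N →ₗ[ℂ] Poly N} :
    IsIntertwining Rp k V ↔ PolyIntertwining Rp k V := by
  constructor
  · intro h
    refine ⟨fun n p hp => (h.map_homogeneous n).le ⟨p, hp, rfl⟩, h.map_const, fun i p => ?_⟩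
    apply polyFun_injective
    rw [← dunklOp_polyFun hRp, h.intertwines]
  · intro h
    refine ⟨h.map_homogeneousSubmodule, h.map_C, fun i p => ?_⟩
    rw [dunklOp_polyFun hRp, h.intertwines]

lemma existsUnique_isIntertwining (hRp : ∀ α ∈ Rp, ‖α‖ ^ 2 = 2) (hk : ∀ α ∈ Rp, 0 ≤ k α)
    (he : DunklEquivariant Rp k) : ∃! V, IsIntertwining Rp k V := by
  obtain ⟨V, hV⟩ := exists_polyIntertwining hRp hk he
  refine ⟨V, (isIntertwining_iff hRp).mpr hV, fun V' hV' => ?_⟩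
  exact ((isIntertwining_iff hRp).mp hV').unique hRp hk hV

lemma polyIntertwining_intertwiner (hRp : ∀ α ∈ Rp, ‖α‖ ^ 2 = 2) (hk : ∀ α ∈ Rp, 0 ≤ k α)
    (he : DunklEquivariant Rp k) : PolyIntertwining Rp k (intertwiner Rp k) :=
  (isIntertwining_iff hRp).mp
    (Classical.epsilon_spec (existsUnique_isIntertwining hRp hk he).exists)

/-- The two claims are proved together, since each termwise application needs the current family to
be still entire. -/
lemma opPow_dunklOp_tsum (hRp : ∀ α ∈ Rp, ‖α‖ ^ 2 = 2) {ι : Type*} {p : ι → Poly N}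
    (hp : EntireFamily p) (ν : Fin N →₀ ℕ) :
    (EntireFamily fun j => dunklPow Rp k ν (p j)) ∧
    opPow (dunklOp Rp k) ν (fun y => ∑' j, polyFun (p j) y) =
      fun y => ∑' j, polyFun (dunklPow Rp k ν (p j)) y := by
  have hiter : ∀ (i : Fin N) (m : ℕ) (q : ι → Poly N), EntireFamily q →
      (EntireFamily fun j => (polyDunkl Rp k i ^ m) (q j)) ∧
      (dunklOp Rp k i)^[m] (fun y => ∑' j, polyFun (q j) y) =
        fun y => ∑' j, polyFun ((polyDunkl Rp k i ^ m) (q j)) y := by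
    intro i m q hq
    induction m with
    | zero => exact ⟨hq, rfl⟩
    | succ m ih =>
      simp only [pow_succ', Module.End.mul_apply, Function.iterate_succ_apply']
      exact ⟨ih.1.polyDunkl hRp i, by rw [ih.2, ih.1.dunklOp_tsum hRp]⟩
  have hlist : ∀ l : List (Fin N),
      (EntireFamily fun j => (l.map fun i => polyDunkl Rp k i ^ ν i).prod (p j)) ∧
      l.foldr (fun i g => (dunklOp Rp k i)^[ν i] g) (fun y => ∑' j, polyFun (p j) y) =
        fun y => ∑' j, polyFun ((l.map fun i => polyDunkl Rp k i ^ ν i).prod (p j)) y := by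
    intro l
    induction l with
    | nil => exact ⟨hp, rfl⟩
    | cons i l ih =>
      simp only [List.map_cons, List.prod_cons, Module.End.mul_apply, List.foldr_cons]
      rw [ih.2]
      exact hiter i (ν i) _ ih.1
  exact hlist _

lemma cEval_normSqPoly (x : CSpace N) : cEval x (normSqPoly N) = ∑ i, x i * x i := by
  simp [normSqPoly, cEval_X]

lemma polyFun_normSqPoly (x : Space N) : polyFun (normSqPoly N) x = ((‖x‖ ^ 2 : ℝ) : ℂ) := by
  rw [polyFun_eq_cEval, cEval_normSqPoly, EuclideanSpace.real_norm_sq_eq]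
  simp [toCSpace, sq]

/-- The expansion of `e^{c|x|²} ∑ F_l(x)` into polynomials. -/
noncomputable def gaussFamily (c : ℝ) (F : ℕ → Poly N) (a : ℕ × ℕ) : Poly N :=
  ((c : ℂ) ^ a.1 / a.1.factorial) • (normSqPoly N ^ a.1 * F a.2)

lemma polyFun_gaussFamily (c : ℝ) (F : ℕ → Poly N) (a : ℕ × ℕ) (x : Space N) :
    polyFun (gaussFamily c F a) x =
      (((c * ‖x‖ ^ 2 : ℝ) : ℂ) ^ a.1 / a.1.factorial) * polyFun (F a.2) x := by
  rw [polyFun_eq_cEval, gaussFamily, map_smul, map_mul, map_pow, ← polyFun_eq_cEval,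
    ← polyFun_eq_cEval, polyFun_normSqPoly, smul_eq_mul]
  push_cast
  rw [mul_pow]; ring

/-- A sequence of polynomials whose sup norms on balls decay factorially. -/
def FactorialBound (F : ℕ → Poly N) : Prop :=
  ∀ r : ℝ, ∃ A : ℝ, 0 ≤ A ∧ ∀ (l : ℕ) (x : CSpace N), ‖x‖ ≤ r →
    ‖cEval x (F l)‖ ≤ A ^ l / l.factorial

variable {F : ℕ → Poly N}

lemma norm_cEval_normSqPoly_le {r : ℝ} {x : CSpace N} (hx : ‖x‖ ≤ r) :
    ‖cEval x (normSqPoly N)‖ ≤ r ^ 2 := by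
  have h0 : 0 ≤ ‖x‖ := norm_nonneg x
  rw [cEval_normSqPoly]
  refine (norm_sum_mul_le x x).trans ?_
  nlinarith

lemma cEval_gaussFamily (c : ℝ) (F : ℕ → Poly N) (a : ℕ × ℕ) (x : CSpace N) :
    cEval x (gaussFamily c F a) =
      ((c : ℂ) * cEval x (normSqPoly N)) ^ a.1 / a.1.factorial * cEval x (F a.2) := by
  rw [gaussFamily, map_smul, map_mul, map_pow, smul_eq_mul, mul_pow]
  ring

lemma FactorialBound.entireFamily_gauss (hF : FactorialBound F) (c : ℝ) :
    EntireFamily (gaussFamily c F) := by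
  intro r
  obtain ⟨A, hA, hb⟩ := hF r
  have hB : 0 ≤ |c| * r ^ 2 := mul_nonneg (abs_nonneg c) (sq_nonneg r)
  refine ⟨fun a => (|c| * r ^ 2) ^ a.1 / a.1.factorial * (A ^ a.2 / a.2.factorial),
    (Real.summable_pow_div_factorial _).mul_of_nonneg (Real.summable_pow_div_factorial _)
      (fun j => div_nonneg (pow_nonneg hB j) (Nat.cast_nonneg _))
      (fun l => div_nonneg (pow_nonneg hA l) (Nat.cast_nonneg _)), fun a x hx => ?_⟩
  have h1 : ‖(c : ℂ) * cEval x (normSqPoly N)‖ ≤ |c| * r ^ 2 := by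
    rw [norm_mul, Complex.norm_real, Real.norm_eq_abs]
    exact mul_le_mul_of_nonneg_left (norm_cEval_normSqPoly_le hx) (abs_nonneg c)
  rw [cEval_gaussFamily, norm_mul, norm_div, norm_pow, Complex.norm_natCast]
  exact mul_le_mul (div_le_div_of_nonneg_right (pow_le_pow_left₀ (norm_nonneg _) h1 _)
    (Nat.cast_nonneg _)) (hb _ _ hx) (norm_nonneg _)
    (div_nonneg (pow_nonneg hB _) (Nat.cast_nonneg _))

lemma FactorialBound.summable_norm (hF : FactorialBound F) (x : Space N) :
    Summable fun l => ‖polyFun (F l) x‖ := by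
  obtain ⟨A, -, hb⟩ := hF ‖x‖
  refine Summable.of_nonneg_of_le (fun _ => norm_nonneg _) (fun l => ?_)
    (Real.summable_pow_div_factorial A)
  rw [polyFun_eq_cEval]
  exact hb l _ (norm_toCSpace x).le

lemma FactorialBound.exp_mul_tsum (hF : FactorialBound F) (c : ℝ) (x : Space N) :
    ((Real.exp (c * ‖x‖ ^ 2) : ℝ) : ℂ) * ∑' l, polyFun (F l) x =
      ∑' a, polyFun (gaussFamily c F a) x := by
  simp only [polyFun_gaussFamily]
  rw [Complex.ofReal_exp, Complex.exp_eq_exp_ℂ, NormedSpace.exp_eq_tsum_div]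
  refine tsum_mul_tsum_of_summable_norm ?_ (hF.summable_norm x)
  exact NormedSpace.norm_expSeries_div_summable _

/-- The common core of both formulas: powers of |x|² move across the pairing as Laplacians, and the
functionals Φ express how the series F reproduces. For S_ν they evaluate at z; for R_ν they are
(-i)^l times evaluation of V at x. -/
lemma opPow_dunklOp_gauss (hRp : ∀ α ∈ Rp, ‖α‖ ^ 2 = 2) (hc : DunklCommute Rp k)
    (he : DunklEquivariant Rp k) (hF : FactorialBound F) {Φ : ℕ → Poly N →ₗ[ℂ] ℂ}
    (hΦ : ∀ p l, dunklPair Rp k p (F l) = Φ l (homogeneousComponent l p))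
    (c : ℝ) (ν : Fin N →₀ ℕ) :
    opPow (dunklOp Rp k) ν
      (fun x => ((Real.exp (c * ‖x‖ ^ 2) : ℝ) : ℂ) * ∑' l, polyFun (F l) x) 0 =
    ∑' j : ℕ, ((c : ℂ) ^ j / j.factorial) *
      Φ (ν.degree - 2 * j) ((polyLaplacian Rp k)^[j] (xPow ν)) := by
  have hE := hF.entireFamily_gauss c
  simp only [hF.exp_mul_tsum c]
  obtain ⟨hE', h⟩ := opPow_dunklOp_tsum (k := k) hRp hE ν
  have h0 : toCSpace (0 : Space N) = 0 := by ext i; simp [toCSpace]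
  have hterm : ∀ a, polyFun (dunklPow Rp k ν (gaussFamily c F a)) 0 =
      ((c : ℂ) ^ a.1 / a.1.factorial) *
        Φ a.2 (homogeneousComponent a.2 ((polyLaplacian Rp k)^[a.1] (xPow ν))) := by
    intro a
    rw [polyFun_eq_cEval, h0, ← dunklPair_monomial, gaussFamily, map_smul, smul_eq_mul,
      dunklPair_normSqPoly_pow_mul hRp hc he, hΦ]
    rfl
  have hs := hE'.summable 0
  rw [h]
  dsimp only
  rw [hs.tsum_prod]
  refine tsum_congr fun j => ?_
  simp only [hterm]
  rw [tsum_mul_left]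
  congr 1
  have hhom : ((polyLaplacian Rp k)^[j] (xPow ν)).IsHomogeneous (ν.degree - 2 * j) :=
    isHomogeneous_polyLaplacian_iterate hRp j (isHomogeneous_monomial _ rfl)
  -- For fixed j only the degree of Δ_k^j x^ν contributes.
  rw [tsum_eq_single (ν.degree - 2 * j), homogeneousComponent_eq_self hhom]
  intro l hl
  rw [homogeneousComponent_of_mem hhom, if_neg hl, map_zero]

lemma expLaplacian_polyFun (hRp : ∀ α ∈ Rp, ‖α‖ ^ 2 = 2) (c : ℝ) (p : Poly N) (x : Space N) :
    expLaplacian Rp k c (polyFun p) x = ∑' j : ℕ, ((c : ℂ) ^ j / j.factorial) *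
      cEval (toCSpace x) ((polyLaplacian Rp k)^[j] p) := by
  rw [expLaplacian]
  refine tsum_congr fun j => ?_
  rw [dunklLaplacian_iterate_polyFun hRp, polyFun_eq_cEval]
  push_cast
  rfl

lemma cEval_smul {p : Poly N} {n : ℕ} (hp : p.IsHomogeneous n) (c : ℂ) (x : CSpace N) :
    cEval (c • x) p = c ^ n * cEval x p := by
  rw [← support_sum_monomial_coeff p, map_sum, map_sum, Finset.mul_sum]
  refine Finset.sum_congr rfl fun ν hν => ?_
  have hdeg : ν.degree = n := by
    by_contra h
    exact mem_support_iff.mp hν (hp.coeff_eq_zero h)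
  have hmon : ∀ y : CSpace N, cEval y (monomial ν (coeff ν p)) = coeff ν p * ∏ i, y i ^ ν i := by
    intro y
    rw [cEval, aeval_monomial, Finsupp.prod_fintype _ _ (by simp)]
    rfl
  rw [hmon, hmon, ← hdeg, Finsupp.degree_eq_sum, ← Finset.prod_pow_eq_pow_sum,
    mul_left_comm, ← Finset.prod_mul_distrib]
  simp [mul_pow]

lemma PolyIntertwining.polyLaplacian_iterate {V : Poly N →ₗ[ℂ] Poly N}
    (hV : PolyIntertwining Rp k V) (j : ℕ) (p : Poly N) :
    (polyLaplacian Rp k)^[j] (V p) = V ((polyLaplacian ∅ k)^[j] p) := by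
  induction j generalizing p with
  | zero => rfl
  | succ j ih =>
    have h1 : polyLaplacian Rp k (V p) = V (polyLaplacian ∅ k p) := by
      simp only [polyLaplacian_apply, hV.intertwines, map_sum, polyDunkl_empty]
    rw [Function.iterate_succ_apply, Function.iterate_succ_apply, h1, ih]

lemma partialD_eq_dunklOp_empty : (partialD : Fin N → (Space N → ℂ) → (Space N → ℂ)) =
    dunklOp ∅ k := by
  funext i f x
  simp [dunklOp]

lemma appellS_eq (hRp : ∀ α ∈ Rp, ‖α‖ ^ 2 = 2) (hk : ∀ α ∈ Rp, 0 ≤ k α)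
    (he : DunklEquivariant Rp k) {t : ℝ} (ht : t ≠ 0) (x : Space N) (ν : Fin N →₀ ℕ) :
    appellS Rp k ν t x = ((1 / (2 * t) : ℝ) : ℂ) ^ ν.degree *
      expLaplacian Rp k (-t) (polyFun (xPow ν)) x := by
  have hV := polyIntertwining_intertwiner hRp hk he
  set V := intertwiner Rp k with hVdef
  set z : CSpace N := ((1 / (2 * t) : ℝ) : ℂ) • toCSpace x with hz
  have hzi : (fun i => ((x i / (2 * t) : ℝ) : ℂ)) = (z : Fin N → ℂ) := by
    funext i
    simp [hz, toCSpace]; ring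
  have hF : FactorialBound (kernelPoly V z) := fun r => by
    refine ⟨|r| * ‖z‖, by positivity, fun l y hy => ?_⟩
    exact hV.norm_cEval_kernelPoly_le hRp hk z l (hy.trans (le_abs_self r))
  have hmain := opPow_dunklOp_gauss hRp hV.dunklCommute he hF
    (Φ := fun _ => (cEval z).toLinearMap)
    (fun p l => hV.dunklPair_kernelPoly hRp z p l) (-1 / (4 * t)) ν
  have hfun : (fun y : Space N => ((Real.exp (-‖y‖ ^ 2 / (4 * t)) : ℝ) : ℂ) *
      kernel Rp k y (fun i => ((x i / (2 * t) : ℝ) : ℂ))) =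
      fun y => ((Real.exp (-1 / (4 * t) * ‖y‖ ^ 2) : ℝ) : ℂ) *
        ∑' l, polyFun (kernelPoly V z l) y := by
    funext y
    rw [hzi]
    congr 3
    ring
  rw [appellS, hfun, hmain, expLaplacian_polyFun hRp, ← tsum_mul_left]
  refine tsum_congr fun j => ?_
  have hx : (xPow ν : Poly N).IsHomogeneous ν.degree := isHomogeneous_monomial _ rfl
  by_cases hj : ν.degree < 2 * j
  · rw [polyLaplacian_iterate_eq_zero hRp hj hx]; simp
  · obtain ⟨m, hm⟩ : ∃ m, ν.degree = m + 2 * j := ⟨ν.degree - 2 * j, by omega⟩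
    have hhom := isHomogeneous_polyLaplacian_iterate (k := k) hRp j hx
    rw [AlgHom.toLinearMap_apply, hz, cEval_smul hhom, hm, Nat.add_sub_cancel, pow_add, pow_mul]
    -- The identity -1/4t = (1/2t)²(-t) restores the 2j factors 1/2t missing from the scaling in
    -- degree |ν| - 2j.
    have hc : (((-1 / (4 * t) : ℝ)) : ℂ) ^ j =
        (((1 / (2 * t) : ℝ) : ℂ) ^ 2) ^ j * ((-t : ℝ) : ℂ) ^ j := by
      rw [← mul_pow]
      congr 1
      have ht' : (t : ℂ) ≠ 0 := by exact_mod_cast ht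
      push_cast
      field_simp
      norm_num
    rw [hc]
    ring

lemma appellR_eq (hRp : ∀ α ∈ Rp, ‖α‖ ^ 2 = 2) (hk : ∀ α ∈ Rp, 0 ≤ k α)
    (he : DunklEquivariant Rp k) (t : ℝ) (x : Space N) (ν : Fin N →₀ ℕ) :
    appellR Rp k ν t x = expLaplacian Rp k (-t) (polyFun (moment Rp k ν)) x := by
  have hV := polyIntertwining_intertwiner hRp hk he
  set V := intertwiner Rp k with hVdef
  set Λ : Poly N →ₗ[ℂ] ℂ := (cEval (toCSpace x)).toLinearMap ∘ₗ V with hΛ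
  set F : ℕ → Poly N := fun l => ((-Complex.I) ^ l) • functionalPoly l Λ with hFdef
  have heval : ∀ l (y : CSpace N), cEval y (F l) =
      (-Complex.I) ^ l * cEval (toCSpace x) (kernelPoly V y l) := by
    intro l y
    rw [hFdef]
    simp only [map_smul, smul_eq_mul]
    rw [cEval_functionalPoly]
    rfl
  have hF : FactorialBound F := fun r => by
    refine ⟨‖x‖ * |r|, by positivity, fun l y hy => ?_⟩
    rw [heval, norm_mul, norm_pow, norm_neg, Complex.norm_I, one_pow, one_mul]
    refine (hV.norm_cEval_kernelPoly_le hRp hk y l (norm_toCSpace x).le).trans ?_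
    have := hy.trans (le_abs_self r)
    gcongr
  -- The derivatives in y are Dunkl operators of the empty root system; the actual roots enter only
  -- through V inside Λ.
  have hmain := opPow_dunklOp_gauss (Rp := ∅) (k := k) (by simp) dunklCommute_empty
    dunklEquivariant_empty hF (Φ := fun l => ((-Complex.I) ^ l) • Λ)
    (fun p l => by
      rw [hFdef]
      simp only [map_smul, dunklPair_empty_functionalPoly, LinearMap.smul_apply]) t ν
  have hfun : (fun y : Space N => kernel Rp k x (fun i => -Complex.I * (y i : ℂ)) *
      ((Real.exp (t * ‖y‖ ^ 2) : ℝ) : ℂ)) =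
      fun y => ((Real.exp (t * ‖y‖ ^ 2) : ℝ) : ℂ) * ∑' l, polyFun (F l) y := by
    funext y
    rw [mul_comm]
    congr 1
    refine tsum_congr fun l => ?_
    rw [polyFun_eq_cEval _ y, heval, polyFun_eq_cEval]
    have hlin : ∑ i, C (-Complex.I * (y i : ℂ)) * X i =
        (-Complex.I) • cLinForm (N := N) (toCSpace y : Fin N → ℂ) := by
      rw [cLinForm, Finset.smul_sum]
      refine Finset.sum_congr rfl fun i _ => ?_
      rw [smul_eq_C_mul, map_mul, mul_assoc]
      rfl
    rw [hlin, smul_pow, smul_comm, map_smul, map_smul, smul_eq_mul]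
    rfl
  rw [appellR, partialD_eq_dunklOp_empty (k := k), hfun, hmain, expLaplacian_polyFun hRp,
    ← tsum_mul_left]
  refine tsum_congr fun j => ?_
  have hx : (xPow ν : Poly N).IsHomogeneous ν.degree := isHomogeneous_monomial _ rfl
  rw [moment, ← hVdef, hV.polyLaplacian_iterate]
  by_cases hj : ν.degree < 2 * j
  · rw [polyLaplacian_iterate_eq_zero (Rp := ∅) (by simp) hj hx]; simp
  · obtain ⟨m, hm⟩ : ∃ m, ν.degree = m + 2 * j := ⟨ν.degree - 2 * j, by omega⟩
    rw [hm, Nat.add_sub_cancel, LinearMap.smul_apply, smul_eq_mul, hΛ, LinearMap.comp_apply,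
      AlgHom.toLinearMap_apply]
    generalize cEval (toCSpace x) (V ((polyLaplacian ∅ k)^[j] (xPow ν))) = w
    -- The powers of i cancel up to i^{2j}; this sign turns t^j into (-t)^j.
    have h1 : Complex.I ^ (m + 2 * j) * (-Complex.I) ^ m = (-1) ^ j := by
      rw [pow_add, mul_right_comm, ← mul_pow, pow_mul, Complex.I_sq]
      simp
    push_cast
    rw [neg_pow (t : ℂ) j, ← h1]
    ring

end

end Dunkl

theorem proposition4p6 (N : ℕ) (R : Finset (Dunkl.Space N))
    (hR : Dunkl.IsNormalizedRootSystem R) (β : Dunkl.Space N)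
    (hβ : ∀ α ∈ R, inner ℝ α β ≠ (0 : ℝ)) (k : Dunkl.Space N → ℝ)
    (hk : Dunkl.IsMultiplicity R k) :
    -- the intertwining operator exists and is unique
    (∃! V : Dunkl.Poly N →ₗ[ℂ] Dunkl.Poly N,
      Dunkl.IsIntertwining (Dunkl.posRoots R β) k V) ∧
    -- the operator series terminates on polynomials
    (∀ (p : Dunkl.Poly N) (n : ℕ), p.totalDegree < 2 * n →
      (Dunkl.dunklLaplacian (Dunkl.posRoots R β) k)^[n] (Dunkl.polyFun p) = 0) ∧
    (∀ (t : ℝ) (x : Dunkl.Space N) (ν : Fin N →₀ ℕ),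
      Dunkl.appellR (Dunkl.posRoots R β) k ν t x =
        Dunkl.expLaplacian (Dunkl.posRoots R β) k (-t)
          (Dunkl.polyFun (Dunkl.moment (Dunkl.posRoots R β) k ν)) x) ∧
    (∀ (t : ℝ) (x : Dunkl.Space N) (ν : Fin N →₀ ℕ), t ≠ 0 →
      Dunkl.appellS (Dunkl.posRoots R β) k ν t x =
        ((1 / (2 * t) : ℝ) : ℂ) ^ ν.degree *
          Dunkl.expLaplacian (Dunkl.posRoots R β) k (-t)
            (Dunkl.polyFun (Dunkl.xPow ν)) x) := by
  have hRp := Dunkl.norm_sq_of_mem_posRoots hR β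
  have hk0 : ∀ α ∈ Dunkl.posRoots R β, 0 ≤ k α :=
    fun α hα => hk.nonneg α (Finset.mem_filter.mp hα).1
  have he := hR.dunklEquivariant hβ hk
  refine ⟨Dunkl.existsUnique_isIntertwining hRp hk0 he, fun p n hpn => ?_,
    fun t x ν => Dunkl.appellR_eq hRp hk0 he t x ν,
    fun t x ν ht => Dunkl.appellS_eq hRp hk0 he ht x ν⟩
  rw [Dunkl.dunklLaplacian_iterate_polyFun hRp,
    Dunkl.polyLaplacian_iterate_eq_zero_of_totalDegree_lt hRp hpn]
  funext x
  simp [Dunkl.polyFun]
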